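/- Let $N\ge 1$ and $m\ge 2$ be integers and let $1\le p<\infty$. Let $Q\subset\mathbf R^N$ be an open cube with sides parallel to the axes and centre $a$. For $u\in W^{m,p}(Q)$ (real valued) put $\|\nabla^k u\|_{L^p(Q)}=\sum_{|\gamma|=k}\|D^\gamma u\|_{L^p(Q)}$, and let $\Pi u$ denote a polynomial $P$ of degree at most $m-1$ that minimizes $\sum_{i=0}^{m-1}\|\nabla^i(u-P)\|_{L^p(Q)}$ (a minimizer exists; it is unique if $p>1$, and if $p=1$ an arbitrary choice of minimizers $u\mapsto \Pi u$ is fixed). For $0\le k\le m-1$ let $\Pi_k u$ be the part of $\Pi u$ of degree at most $k$ when $\Pi u$ is written in powers of $x-a$, and let $\Pi_k^{\rm co}u=\Pi u-\Pi_k u$. For $\mathcal A\subset W^{m,p}(Q)$ and $\alpha>0$ let $T^{\alpha}_{m,k,p,\mathcal A}$ be the set of all $u\in\mathcal A$ with $$\|\Pi_k u\|_{L^p(Q)}\ge\alpha\,\|\Pi^{\rm co}_k u\|_{L^p(Q)}\quad\text{and}\quad \|u-\Pi u\|_{L^p(Q)}\le\tfrac12\|\Pi u\|_{L^p(Q)},$$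 and let $$\Theta^{\alpha}_{m,k,p}(\mathcal A)=\min\Bigl[\ \inf_{u}\ \frac{\|\nabla^m u\|^p_{L^p(Q)}}{\|\Pi_k u\|^p_{L^p(Q)}},\ 1\Bigr],$$ where the infimum is over the $u\in T^{\alpha}_{m,k,p,\mathcal A}$ with $\Pi_k u\ne 0$ (that is, over the nonzero elements of $T^{\alpha}_{m,k,p,\mathcal A}$) and is $+\infty$ if there are none. **Theorem.** There is $\alpha_0=\alpha_0(N,m,p)>0$ such that for every $\alpha\ge\alpha_0$ there are constants $\alpha'>0$ and $c>0$, depending only on $N$, $m$, $p$ and $\alpha$, with the following property: for every such cube $Q$, every choice of $\Pi$, and every set $\mathcal A\subset W^{m,p}(Q)$ of functions that are nonnegative almost everywhere in $Q$, $$\Theta^{\alpha}_{m,1,p}(\mathcal A)\ \ge\ c\,\Theta^{\alpha'}_{m,0,p}(\mathcal A).$$ -/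

import Mathlib

open MeasureTheory
open scoped ENNReal ContDiff

namespace PolyCap

noncomputable section

/-! Points of `ℝ^N` are functions `Fin N → ℝ`; no norm on `ℝ^N` enters the definitions,
only Lebesgue measure, partial derivatives and coordinates. -/

/-- The `i`-th partial derivative of `f`. -/
def partialD {N : ℕ} (i : Fin N) (f : (Fin N → ℝ) → ℝ) : (Fin N → ℝ) → ℝ :=
  fun x => fderiv ℝ f x (Pi.single i 1)

/-- The classical derivative `D^γ f = ∂₁^{γ₁} ⋯ ∂_N^{γ_N} f` for a multi-index `γ`. -/
def multiD {N : ℕ} (γ : Fin N → ℕ) (f : (Fin N → ℝ) → ℝ) : (Fin N → ℝ) → ℝ :=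
  (List.finRange N).foldr (fun i g => (partialD i)^[γ i] g) f

/-- `v` is the weak (distributional) derivative `D^γ u` on the open set `Ω`. -/
def HasWeakDeriv {N : ℕ} (Ω : Set (Fin N → ℝ)) (γ : Fin N → ℕ)
    (u v : (Fin N → ℝ) → ℝ) : Prop :=
  LocallyIntegrableOn u Ω ∧ LocallyIntegrableOn v Ω ∧
    ∀ φ : (Fin N → ℝ) → ℝ, ContDiff ℝ ∞ φ → HasCompactSupport φ → tsupport φ ⊆ Ω →
      ∫ x in Ω, u x * multiD γ φ x = (-1) ^ (∑ i, γ i) * ∫ x in Ω, v x * φ x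

open Classical in
/-- A representative of the weak derivative `D^γ u` on `Ω` (it is unique almost everywhere);
the value `0` is used if there is none. -/
def weakDeriv {N : ℕ} (Ω : Set (Fin N → ℝ)) (γ : Fin N → ℕ)
    (u : (Fin N → ℝ) → ℝ) : (Fin N → ℝ) → ℝ :=
  if h : ∃ v, HasWeakDeriv Ω γ u v then h.choose else 0

/-- `‖f‖_{L^p(Ω)}`, as an extended nonnegative number. -/
def lpNorm {N : ℕ} (p : ℝ) (Ω : Set (Fin N → ℝ)) (f : (Fin N → ℝ) → ℝ) : ℝ≥0∞ :=
  eLpNorm f (ENNReal.ofReal p) (volume.restrict Ω)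

/-- The Sobolev space `W^{m,p}(Ω)` of real functions on `Ω` (through representatives defined on
`ℝ^N`, whose values outside `Ω` play no role): all the weak derivatives of order at most `m` exist
and lie in `L^p(Ω)`. -/
def sobolev {N : ℕ} (m : ℕ) (p : ℝ) (Ω : Set (Fin N → ℝ)) : Set ((Fin N → ℝ) → ℝ) :=
  {u | MemLp u (ENNReal.ofReal p) (volume.restrict Ω) ∧
    ∀ γ : Fin N → ℕ, ∑ i, γ i ≤ m →
      ∃ v, HasWeakDeriv Ω γ u v ∧ MemLp v (ENNReal.ofReal p) (volume.restrict Ω)}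

/-- The nonnegative cone `W^{m,p}(Ω)_+`. -/
def sobolevNonneg {N : ℕ} (m : ℕ) (p : ℝ) (Ω : Set (Fin N → ℝ)) : Set ((Fin N → ℝ) → ℝ) :=
  {u | u ∈ sobolev m p Ω ∧ ∀ᵐ x ∂(volume.restrict Ω), 0 ≤ u x}

/-- `‖∇^k u‖_{L^p(Ω)} = ∑_{|γ| = k} ‖D^γ u‖_{L^p(Ω)}`; the sum is over the multi-indices `γ` of
order `k`. -/
def gradNorm {N : ℕ} (k : ℕ) (p : ℝ) (Ω : Set (Fin N → ℝ)) (u : (Fin N → ℝ) → ℝ) : ℝ≥0∞ :=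
  ∑ γ ∈ Finset.piAntidiag (Finset.univ : Finset (Fin N)) k, lpNorm p Ω (weakDeriv Ω γ u)

/-- The open cube with centre `a` and side length `ℓ`. -/
def cube {N : ℕ} (a : Fin N → ℝ) (ℓ : ℝ) : Set (Fin N → ℝ) :=
  {x | ∀ i, |x i - a i| < ℓ / 2}

/-- The polynomial function `x ↦ P(x - a)`. Polynomials are written in powers of `x - a`, where `a`
is the centre of the cube. -/
def polyFun {N : ℕ} (a : Fin N → ℝ) (P : MvPolynomial (Fin N) ℝ) : (Fin N → ℝ) → ℝ :=
  fun x => MvPolynomial.eval (fun i => x i - a i) P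

/-- The part of degree at most `k` of a polynomial. -/
def lowPart {N : ℕ} (k : ℕ) (P : MvPolynomial (Fin N) ℝ) : MvPolynomial (Fin N) ℝ :=
  ∑ i ∈ Finset.range (k + 1), MvPolynomial.homogeneousComponent i P

/-- The quantity `∑_{i=0}^r ‖∇^i (u - P)‖_{L^p(Q)}`, where `Q` is the cube with centre `a` and
side length `ℓ`. -/
def approxError {N : ℕ} (r : ℕ) (p : ℝ) (a : Fin N → ℝ) (ℓ : ℝ) (u : (Fin N → ℝ) → ℝ)
    (P : MvPolynomial (Fin N) ℝ) : ℝ≥0∞ :=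
  ∑ i ∈ Finset.range (r + 1), gradNorm i p (cube a ℓ) (u - polyFun a P)

/-- `Pr` is a projection operator `Π_{r,r,p}`: it sends each `u ∈ W^{r+1,p}(Q)` to a polynomial of
degree at most `r` that minimizes `∑_{i=0}^r ‖∇^i (u - P)‖_{L^p(Q)}`. (The minimizer is unique for
`p > 1`; for `p = 1` any choice is admitted.) -/
def IsProjection {N : ℕ} (r : ℕ) (p : ℝ) (a : Fin N → ℝ) (ℓ : ℝ)
    (Pr : ((Fin N → ℝ) → ℝ) → MvPolynomial (Fin N) ℝ) : Prop :=
  ∀ u ∈ sobolev (r + 1) p (cube a ℓ),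
    (Pr u).totalDegree ≤ r ∧
      ∀ P : MvPolynomial (Fin N) ℝ, P.totalDegree ≤ r →
        approxError r p a ℓ u (Pr u) ≤ approxError r p a ℓ u P

/-- The class `T^α_{k,p,A}` of test functions, for the projection operator `Pr = Π_{m-1,m-1,p}`:
those `u ∈ A` with `‖Π_{m-1,k,p} u‖ ≥ α ‖Π^co_{m-1,k,p} u‖` and
`‖u - Π_{m-1,m-1,p} u‖ ≤ (1/2) ‖Π_{m-1,m-1,p} u‖`, norms in `L^p(Q)`. -/
def testClass {N : ℕ} (k : ℕ) (p : ℝ) (a : Fin N → ℝ) (ℓ : ℝ)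
    (Pr : ((Fin N → ℝ) → ℝ) → MvPolynomial (Fin N) ℝ) (α : ℝ)
    (A : Set ((Fin N → ℝ) → ℝ)) : Set ((Fin N → ℝ) → ℝ) :=
  {u | u ∈ A ∧
    ENNReal.ofReal α * lpNorm p (cube a ℓ) (polyFun a (Pr u - lowPart k (Pr u)))
      ≤ lpNorm p (cube a ℓ) (polyFun a (lowPart k (Pr u))) ∧
    lpNorm p (cube a ℓ) (u - polyFun a (Pr u))
      ≤ 2⁻¹ * lpNorm p (cube a ℓ) (polyFun a (Pr u))}

/-- The polynomial capacity `Θ^α_{m,k,p}(A)`, for the projection operator `Pr = Π_{m-1,m-1,p}`: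
the minimum of `1` and of the infimum over the test functions `u` of
`‖∇^m u‖^p / ‖Π_{m-1,k,p} u‖^p`. The quotient is taken where its denominator is not zero; the only
test function with zero denominator is `u = 0`, which is no competitor. -/
def Theta {N : ℕ} (m k : ℕ) (p : ℝ) (a : Fin N → ℝ) (ℓ : ℝ)
    (Pr : ((Fin N → ℝ) → ℝ) → MvPolynomial (Fin N) ℝ) (α : ℝ)
    (A : Set ((Fin N → ℝ) → ℝ)) : ℝ≥0∞ :=
  min (⨅ u ∈ {u ∈ testClass k p a ℓ Pr α A |
      lpNorm p (cube a ℓ) (polyFun a (lowPart k (Pr u))) ≠ 0},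
    gradNorm m p (cube a ℓ) u ^ p / lpNorm p (cube a ℓ) (polyFun a (lowPart k (Pr u))) ^ p) 1

/-! Best polynomial approximations exist, so that projection operators exist. -/

section Existence

variable {N : ℕ}

lemma isOpen_cube (a : Fin N → ℝ) (ℓ : ℝ) : IsOpen (cube a ℓ) := by
  have : cube a ℓ = ⋂ i, {x : Fin N → ℝ | |x i - a i| < ℓ / 2} := by
    ext x; simp [cube]
  rw [this]
  exact isOpen_iInter_of_finite fun i => isOpen_lt (by fun_prop) (by fun_prop)

lemma cube_subset_Icc (a : Fin N → ℝ) (ℓ : ℝ) :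
    cube a ℓ ⊆ Set.Icc (fun i => a i - ℓ / 2) (fun i => a i + ℓ / 2) := by
  intro x hx
  refine ⟨fun i => ?_, fun i => ?_⟩ <;> have := abs_lt.1 (hx i) <;> simp only <;> linarith

lemma contDiff_partialD {f : (Fin N → ℝ) → ℝ} (hf : ContDiff ℝ ∞ f) (i : Fin N) :
    ContDiff ℝ ∞ (partialD i f) :=
  (hf.fderiv_right (m := ∞) (by simp)).clm_apply contDiff_const

lemma contDiff_partialD_iter {f : (Fin N → ℝ) → ℝ} (hf : ContDiff ℝ ∞ f) (i : Fin N) (n : ℕ) :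
    ContDiff ℝ ∞ ((partialD i)^[n] f) := by
  induction n generalizing f with
  | zero => exact hf
  | succ n ih => exact ih (contDiff_partialD hf i)

lemma tsupport_partialD (f : (Fin N → ℝ) → ℝ) (i : Fin N) :
    tsupport (partialD i f) ⊆ tsupport f :=
  tsupport_fderiv_apply_subset ℝ _

lemma tsupport_partialD_iter (f : (Fin N → ℝ) → ℝ) (i : Fin N) (n : ℕ) :
    tsupport ((partialD i)^[n] f) ⊆ tsupport f := by
  induction n generalizing f with
  | zero => exact subset_rfl
  | succ n ih => exact (ih _).trans (tsupport_partialD f i)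

lemma foldr_props (γ : Fin N → ℕ) {φ : (Fin N → ℝ) → ℝ} (hφ : ContDiff ℝ ∞ φ)
    (l : List (Fin N)) :
    ContDiff ℝ ∞ (l.foldr (fun i g => (partialD i)^[γ i] g) φ) ∧
      tsupport (l.foldr (fun i g => (partialD i)^[γ i] g) φ) ⊆ tsupport φ := by
  induction l with
  | nil => exact ⟨hφ, subset_rfl⟩
  | cons i l ih =>
    exact ⟨contDiff_partialD_iter ih.1 i _, (tsupport_partialD_iter _ i _).trans ih.2⟩

lemma hcs_of_tsupport {f φ : (Fin N → ℝ) → ℝ} (hφ : HasCompactSupport φ)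
    (h : tsupport f ⊆ tsupport φ) : HasCompactSupport f :=
  IsCompact.of_isClosed_subset hφ (isClosed_tsupport f) h

lemma integral_partialD {f φ : (Fin N → ℝ) → ℝ} (hf : ContDiff ℝ ∞ f) (hφ : ContDiff ℝ ∞ φ)
    (hc : HasCompactSupport φ) (i : Fin N) :
    ∫ x, f x * partialD i φ x = - ∫ x, partialD i f x * φ x := by
  have hpf := (contDiff_partialD hf i).continuous
  have hpφ := (contDiff_partialD hφ i).continuous
  have hcp : HasCompactSupport (partialD i φ) := hcs_of_tsupport hc (tsupport_partialD φ i)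
  exact integral_mul_fderiv_eq_neg_fderiv_mul_of_integrable
    ((hpf.mul hφ.continuous).integrable_of_hasCompactSupport hc.mul_left)
    ((hf.continuous.mul hpφ).integrable_of_hasCompactSupport hcp.mul_left)
    ((hf.continuous.mul hφ.continuous).integrable_of_hasCompactSupport hc.mul_left)
    (fun x _ => (hf.differentiable (by simp)) x) (fun x _ => (hφ.differentiable (by simp)) x)

lemma integral_partialD_iter {f φ : (Fin N → ℝ) → ℝ} (hf : ContDiff ℝ ∞ f)
    (hφ : ContDiff ℝ ∞ φ) (hc : HasCompactSupport φ) (i : Fin N) (n : ℕ) :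
    ∫ x, f x * (partialD i)^[n] φ x = (-1) ^ n * ∫ x, (partialD i)^[n] f x * φ x := by
  induction n generalizing f φ with
  | zero => simp
  | succ n ih =>
    rw [Function.iterate_succ_apply, ih hf (contDiff_partialD hφ i)
      (hcs_of_tsupport hc (tsupport_partialD φ i)),
      integral_partialD (contDiff_partialD_iter hf i n) hφ hc, Function.iterate_succ_apply',
      pow_succ]
    ring

lemma integral_foldr (γ : Fin N → ℕ) {f φ : (Fin N → ℝ) → ℝ} (hf : ContDiff ℝ ∞ f)
    (hφ : ContDiff ℝ ∞ φ) (hc : HasCompactSupport φ) (l : List (Fin N)) :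
    ∫ x, f x * l.foldr (fun i g => (partialD i)^[γ i] g) φ x
      = (-1) ^ (l.map γ).sum * ∫ x, l.foldl (fun g i => (partialD i)^[γ i] g) f x * φ x := by
  induction l generalizing f with
  | nil => simp
  | cons i l ih =>
    have h := foldr_props γ hφ l
    rw [List.foldr_cons, integral_partialD_iter hf h.1 (hcs_of_tsupport hc h.2),
      ih (contDiff_partialD_iter hf i _), List.map_cons, List.sum_cons, pow_add, List.foldl_cons]
    ring

/-- The iterated derivative, with the order of the differentiations reversed. -/
def revD (γ : Fin N → ℕ) (f : (Fin N → ℝ) → ℝ) : (Fin N → ℝ) → ℝ :=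
  (List.finRange N).foldl (fun g i => (partialD i)^[γ i] g) f

lemma contDiff_revD (γ : Fin N → ℕ) {f : (Fin N → ℝ) → ℝ} (hf : ContDiff ℝ ∞ f) :
    ContDiff ℝ ∞ (revD γ f) := by
  unfold revD
  induction (List.finRange N) generalizing f with
  | nil => exact hf
  | cons i l ih => exact ih (contDiff_partialD_iter hf i _)

lemma hasWeakDeriv_of_contDiff (Ω : Set (Fin N → ℝ)) (γ : Fin N → ℕ)
    {f : (Fin N → ℝ) → ℝ} (hf : ContDiff ℝ ∞ f) : HasWeakDeriv Ω γ f (revD γ f) := by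
  refine ⟨hf.continuous.locallyIntegrable.locallyIntegrableOn _,
    (contDiff_revD γ hf).continuous.locallyIntegrable.locallyIntegrableOn _, ?_⟩
  intro φ hφ hc hs
  rw [setIntegral_eq_integral_of_forall_compl_eq_zero,
    setIntegral_eq_integral_of_forall_compl_eq_zero]
  · have h := integral_foldr γ hf hφ hc (List.finRange N)
    rw [← List.ofFn_eq_map, List.sum_ofFn] at h
    exact h
  · intro x hx
    rw [image_eq_zero_of_notMem_tsupport fun h => hx (hs h), mul_zero]
  · intro x hx
    unfold multiD
    rw [image_eq_zero_of_notMem_tsupport fun h => hx (hs ((foldr_props γ hφ _).2 h)), mul_zero]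

lemma integrableOn_mul_test {Ω : Set (Fin N → ℝ)} (hΩ : IsOpen Ω) {u φ : (Fin N → ℝ) → ℝ}
    (hu : LocallyIntegrableOn u Ω) (hφ : Continuous φ) (hc : HasCompactSupport φ)
    (hs : tsupport φ ⊆ Ω) : IntegrableOn (fun x => u x * φ x) Ω := by
  have h1 : IntegrableOn u (tsupport φ) := hu.integrableOn_compact_subset hs hc
  have h2 : IntegrableOn (fun x => u x * φ x) (tsupport φ) :=
    h1.mul_continuousOn hφ.continuousOn hc
  exact h2.of_forall_sdiff_eq_zero hΩ.measurableSet fun x hx => by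
    rw [image_eq_zero_of_notMem_tsupport hx.2, mul_zero]

lemma HasWeakDeriv.sub {Ω : Set (Fin N → ℝ)} (hΩ : IsOpen Ω) {γ : Fin N → ℕ}
    {u v u' v' : (Fin N → ℝ) → ℝ} (h : HasWeakDeriv Ω γ u v) (h' : HasWeakDeriv Ω γ u' v') :
    HasWeakDeriv Ω γ (u - u') (v - v') := by
  refine ⟨h.1.sub h'.1, h.2.1.sub h'.2.1, fun φ hφ hc hs => ?_⟩
  have hp : ContDiff ℝ ∞ (multiD γ φ) ∧ tsupport (multiD γ φ) ⊆ tsupport φ :=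
    foldr_props γ hφ (List.finRange N)
  have hc2 := hcs_of_tsupport hc hp.2
  simp only [Pi.sub_apply, sub_mul]
  rw [integral_sub (integrableOn_mul_test hΩ h.1 hp.1.continuous hc2 (hp.2.trans hs))
      (integrableOn_mul_test hΩ h'.1 hp.1.continuous hc2 (hp.2.trans hs)),
    integral_sub (integrableOn_mul_test hΩ h.2.1 hφ.continuous hc hs)
      (integrableOn_mul_test hΩ h'.2.1 hφ.continuous hc hs), h.2.2 φ hφ hc hs,
    h'.2.2 φ hφ hc hs, mul_sub]

lemma HasWeakDeriv.ae_eq {Ω : Set (Fin N → ℝ)} (hΩ : IsOpen Ω) {γ : Fin N → ℕ}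
    {u v w : (Fin N → ℝ) → ℝ} (hv : HasWeakDeriv Ω γ u v) (hw : HasWeakDeriv Ω γ u w) :
    v =ᵐ[volume.restrict Ω] w := by
  have h0 := hΩ.ae_eq_zero_of_integral_contDiff_smul_eq_zero (μ := volume)
    (hv.2.1.sub hw.2.1) (fun φ hφ hc hs => by
      have h := (hv.sub hΩ hw).2.2 φ hφ hc hs
      simp only [sub_self, Pi.zero_apply, zero_mul, integral_zero] at h
      have h1 : ∫ x in Ω, (v - w) x * φ x = 0 := by
        rcases mul_eq_zero.1 h.symm with h2 | h2
        · exact absurd h2 (pow_ne_zero _ (by norm_num))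
        · exact h2
      rw [setIntegral_eq_integral_of_forall_compl_eq_zero (fun x hx => by
        rw [image_eq_zero_of_notMem_tsupport fun h => hx (hs h), mul_zero])] at h1
      simpa only [smul_eq_mul, mul_comm] using h1)
  rw [Filter.EventuallyEq, ae_restrict_iff' hΩ.measurableSet]
  filter_upwards [h0] with x hx hxΩ
  exact sub_eq_zero.1 (hx hxΩ)

lemma HasWeakDeriv.weakDeriv_ae_eq {Ω : Set (Fin N → ℝ)} (hΩ : IsOpen Ω) {γ : Fin N → ℕ}
    {u v : (Fin N → ℝ) → ℝ} (hv : HasWeakDeriv Ω γ u v) :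
    weakDeriv Ω γ u =ᵐ[volume.restrict Ω] v := by
  have h : ∃ v, HasWeakDeriv Ω γ u v := ⟨v, hv⟩
  rw [weakDeriv, dif_pos h]
  exact h.choose_spec.ae_eq hΩ hv

lemma contDiff_polyFun (a : Fin N → ℝ) (P : MvPolynomial (Fin N) ℝ) :
    ContDiff ℝ ∞ (polyFun a P) := by
  unfold polyFun
  induction P using MvPolynomial.induction_on with
  | C c => simpa using contDiff_const
  | add p q hp hq => simpa using hp.add hq
  | mul_X p i hp => simpa using hp.mul ((contDiff_apply ℝ ℝ i).sub contDiff_const)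

lemma memLp_cube (p : ℝ) (a : Fin N → ℝ) (ℓ : ℝ) {f : (Fin N → ℝ) → ℝ} (hf : Continuous f) :
    MemLp f (ENNReal.ofReal p) (volume.restrict (cube a ℓ)) := by
  have hK : IsCompact (Set.Icc (fun i => a i - ℓ / 2) (fun i => a i + ℓ / 2)) := isCompact_Icc
  have : IsFiniteMeasure (volume.restrict (cube a ℓ)) :=
    ⟨by rw [Measure.restrict_apply_univ]
        exact (measure_mono (cube_subset_Icc a ℓ)).trans_lt hK.measure_lt_top⟩
  obtain ⟨C, hC⟩ := hK.exists_bound_of_continuousOn hf.continuousOn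
  refine MemLp.of_bound hf.aestronglyMeasurable C ?_
  rw [ae_restrict_iff' (isOpen_cube a ℓ).measurableSet]
  exact Filter.Eventually.of_forall fun x hx => hC x (cube_subset_Icc a ℓ hx)

lemma partialD_iter_linear (i : Fin N) (n : ℕ) {f g : (Fin N → ℝ) → ℝ} (hf : ContDiff ℝ ∞ f)
    (hg : ContDiff ℝ ∞ g) (s t : ℝ) :
    (partialD i)^[n] (s • f + t • g) = s • (partialD i)^[n] f + t • (partialD i)^[n] g := by
  induction n generalizing f g with
  | zero => rfl
  | succ n ih =>
    have : partialD i (s • f + t • g) = s • partialD i f + t • partialD i g := by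
      ext x
      have hf' := hf.differentiable (by simp) x
      have hg' := hg.differentiable (by simp) x
      simp only [partialD, Pi.add_apply, Pi.smul_apply]
      rw [fderiv_add (hf'.const_smul s) (hg'.const_smul t), fderiv_const_smul hf',
        fderiv_const_smul hg']
      rfl
    rw [Function.iterate_succ_apply, this, ih (contDiff_partialD hf i) (contDiff_partialD hg i)]
    rfl

lemma revD_linear (γ : Fin N → ℕ) {f g : (Fin N → ℝ) → ℝ} (hf : ContDiff ℝ ∞ f)
    (hg : ContDiff ℝ ∞ g) (s t : ℝ) : revD γ (s • f + t • g) = s • revD γ f + t • revD γ g := by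
  unfold revD
  induction (List.finRange N) generalizing f g with
  | nil => rfl
  | cons i l ih =>
    rw [List.foldl_cons, partialD_iter_linear i _ hf hg,
      ih (contDiff_partialD_iter hf i _) (contDiff_partialD_iter hg i _)]
    rfl

lemma polyFun_linear (a : Fin N → ℝ) (P R : MvPolynomial (Fin N) ℝ) (s t : ℝ) :
    polyFun a (s • P + t • R) = s • polyFun a P + t • polyFun a R := by
  ext x; simp [polyFun, MvPolynomial.smul_eval]

/-- The weak derivative `D^γ P` on the cube as an element of `L^p`, linearly in `P`. -/
def derivLp (p : ℝ) (a : Fin N → ℝ) (ℓ : ℝ) (γ : Fin N → ℕ) :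
    MvPolynomial (Fin N) ℝ →ₗ[ℝ] Lp ℝ (ENNReal.ofReal p) (volume.restrict (cube a ℓ)) where
  toFun P := (memLp_cube p a ℓ (contDiff_revD γ (contDiff_polyFun a P)).continuous).toLp _
  map_add' P R := by
    rw [← MemLp.toLp_add]
    congr 1
    have h := polyFun_linear a P R 1 1
    have h2 := revD_linear γ (contDiff_polyFun a P) (contDiff_polyFun a R) 1 1
    simp only [one_smul] at h h2
    rw [h, h2]
  map_smul' s P := by
    rw [RingHom.id_apply, ← MemLp.toLp_const_smul]
    congr 1
    have h := polyFun_linear a P P s 0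
    have h2 := revD_linear γ (contDiff_polyFun a P) (contDiff_polyFun a P) s 0
    simp only [zero_smul, add_zero] at h h2
    rw [h, h2]

/-- Projection operators exist. -/
theorem exists_isProjection (r : ℕ) (p : ℝ) (hp : 1 ≤ p) (a : Fin N → ℝ) (ℓ : ℝ) :
    ∃ Pr, IsProjection r p a ℓ Pr := by
  have : Fact (1 ≤ ENNReal.ofReal p) := ⟨by simpa using ENNReal.ofReal_le_ofReal hp⟩
  suffices H : ∀ u, ∃ P : MvPolynomial (Fin N) ℝ, u ∈ sobolev (r + 1) p (cube a ℓ) →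
      P.totalDegree ≤ r ∧ ∀ R : MvPolynomial (Fin N) ℝ, R.totalDegree ≤ r →
        approxError r p a ℓ u P ≤ approxError r p a ℓ u R by
    choose Pr hPr using H
    exact ⟨Pr, hPr⟩
  intro u
  by_cases hu : u ∈ sobolev (r + 1) p (cube a ℓ)
  swap
  · exact ⟨0, fun h => absurd h hu⟩
  have hv : ∀ γ : Fin N → ℕ, ∃ v, ∑ i, γ i ≤ r + 1 → HasWeakDeriv (cube a ℓ) γ u v ∧
      MemLp v (ENNReal.ofReal p) (volume.restrict (cube a ℓ)) := by
    intro γ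
    by_cases h : ∑ i, γ i ≤ r + 1
    · obtain ⟨v, hv⟩ := hu.2 γ h
      exact ⟨v, fun _ => hv⟩
    · exact ⟨0, fun h' => absurd h' h⟩
  choose v hv using hv
  let ι := Σ i : Fin (r + 1), {γ : Fin N → ℕ // γ ∈ Finset.piAntidiag Finset.univ (i : ℕ)}
  have hι : ∀ j : ι, ∑ i, j.2.1 i ≤ r + 1 := by
    rintro ⟨i, γ, hγ⟩
    rw [Finset.mem_piAntidiag] at hγ
    have h1 : ∑ j, γ j = i := hγ.1
    have h2 := i.2
    change ∑ j, γ j ≤ r + 1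
    omega
  let F := PiLp 1 (fun _ : ι => Lp ℝ (ENNReal.ofReal p) (volume.restrict (cube a ℓ)))
  let U : F := WithLp.toLp 1 fun j => (hv j.2.1 (hι j)).2.toLp _
  let Φ : MvPolynomial (Fin N) ℝ →ₗ[ℝ] F :=
    (WithLp.linearEquiv 1 ℝ _).symm.toLinearMap ∘ₗ LinearMap.pi fun j => derivLp p a ℓ j.2.1
  have herr : ∀ P, approxError r p a ℓ u P = ENNReal.ofReal ‖U - Φ P‖ := by
    intro P
    rw [PiLp.norm_eq_sum (by simp)]
    simp only [ENNReal.toReal_one, Real.rpow_one, div_one]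
    rw [ENNReal.ofReal_sum_of_nonneg (fun _ _ => norm_nonneg _), Fintype.sum_sigma, approxError,
      ← Fin.sum_univ_eq_sum_range (fun i => gradNorm i p (cube a ℓ) (u - polyFun a P))]
    refine Finset.sum_congr rfl fun i _ => ?_
    rw [gradNorm, ← Finset.sum_coe_sort]
    refine Finset.sum_congr rfl fun γ _ => ?_
    have hw := (hv γ.1 (hι ⟨i, γ⟩)).1.sub (isOpen_cube a ℓ)
      (hasWeakDeriv_of_contDiff (cube a ℓ) γ.1 (contDiff_polyFun a P))
    rw [lpNorm, eLpNorm_congr_ae (hw.weakDeriv_ae_eq (isOpen_cube a ℓ))]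
    have m1 := (hv γ.1 (hι ⟨i, γ⟩)).2
    have m2 := memLp_cube p a ℓ (contDiff_revD γ.1 (contDiff_polyFun a P)).continuous
    have hU : (U - Φ P) ⟨i, γ⟩ = MemLp.toLp _ (m1.sub m2) := by
      rw [MemLp.toLp_sub m1 m2]
      rfl
    rw [hU, Lp.norm_toLp, ENNReal.ofReal_toReal]
    exact (m1.sub m2).eLpNorm_ne_top
  let W : Submodule ℝ F := (MvPolynomial.restrictTotalDegree (Fin N) ℝ r).map Φ
  have hfin : FiniteDimensional ℝ W := inferInstance
  have hprop : ProperSpace W := FiniteDimensional.proper ℝ W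
  have hcont : Continuous fun w : W => ‖U - (w : F)‖ := by fun_prop
  obtain ⟨w, hw⟩ := hcont.exists_forall_le (by
    have h1 : Filter.Tendsto (fun w : W => ‖w‖ - ‖U‖) (Filter.cocompact W) Filter.atTop :=
      Filter.tendsto_atTop_add_const_right _ _ (tendsto_norm_cocompact_atTop (E := W))
    refine Filter.tendsto_atTop_mono (fun w => ?_) h1
    rw [norm_sub_rev]
    exact norm_sub_norm_le (w : F) U)
  obtain ⟨P, hP, hPw⟩ := Submodule.mem_map.1 w.2
  refine ⟨P, fun _ => ⟨(MvPolynomial.mem_restrictTotalDegree _ _ _).1 hP, fun R hR => ?_⟩⟩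
  rw [herr, herr, hPw]
  exact ENNReal.ofReal_le_ofReal (hw ⟨Φ R, Submodule.mem_map_of_mem
    ((MvPolynomial.mem_restrictTotalDegree _ _ _).2 hR)⟩)

end Existence

end

end PolyCap

namespace PolyCap

noncomputable section

variable {N : ℕ}

/-! Write the projection as P = b + s + R, with b constant, s linear in x - a and R of higher
degree; norms are in L^p(Q). For α ≥ 2/δ the first condition of the test class makes R small against
b + s. If δ‖s‖ ≤ ‖b‖, then u is also a test function for k = 0 with a fixed α', and ‖b + s‖ is at
most a multiple of ‖b‖, so the two quotients are comparable. Otherwise P is close to s, and the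
second condition gives ‖u - s‖ ≤ (1/2 + 3δ)‖s‖. Nonnegativity works against this: |u - s| ≥ s⁻, and
reflection in the centre of the cube gives ‖s⁻‖ = 2^(-1/p)‖s‖. For p > 1 this is a contradiction
once δ is small, because 2^(-1/p) > 1/2.

For p = 1 the two constants coincide. The identity |u - s| = |u - s⁺| + s⁻ (`abs_sub_eq_of_nonneg`)
then only forces u to be L¹-close to s⁺. But s⁺ has a kink, so ∇^m u cannot be small: integrating u
against the m-th derivative of a product test function, in the direction of the largest coefficient
of s, bounds ℓ^m ‖∇^m u‖ from below by a multiple of ‖s‖ (`exists_gradNorm_ge`).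

The factor ℓ^m is harmless only on cubes of bounded side. Large cubes are excluded by the minimality
of P (`side_le_of_minimal`): replacing P by P + k - s/2 with a suitable constant k lowers the zeroth
order error by an amount of order ‖s‖, raises the first order error by at most the order of ‖s‖/ℓ,
and leaves the higher orders unchanged. The dichotomy is assembled in `exists_const_or_gradNorm_ge`.
-/

/-! ### Constant and linear parts of a polynomial. -/

/-- The linear form `x ↦ l · (x - a)`. -/
def linForm (a l : Fin N → ℝ) : (Fin N → ℝ) → ℝ := fun x => ∑ i, l i * (x i - a i)

lemma homogeneousComponent_one_eq (P : MvPolynomial (Fin N) ℝ) :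
    MvPolynomial.homogeneousComponent 1 P
      = ∑ i, MvPolynomial.C (P.coeff (Finsupp.single i 1)) * MvPolynomial.X i := by
  ext d
  rw [MvPolynomial.coeff_homogeneousComponent, MvPolynomial.coeff_sum]
  simp only [MvPolynomial.coeff_C_mul, MvPolynomial.coeff_X, mul_ite, mul_one, mul_zero]
  split_ifs with h
  · obtain ⟨i, rfl⟩ := (Finsupp.sum_eq_one_iff d).1 h
    rw [Finset.sum_eq_single i]
    · simp
    · intro j _ hj
      rw [if_neg]
      intro h'
      exact hj ((Finsupp.single_left_inj one_ne_zero).1 h')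
    · simp
  · symm
    refine Finset.sum_eq_zero fun i _ => if_neg ?_
    rintro rfl
    simp at h

lemma polyFun_homogeneousComponent_one (a : Fin N → ℝ) (P : MvPolynomial (Fin N) ℝ) :
    polyFun a (MvPolynomial.homogeneousComponent 1 P)
      = linForm a fun i => P.coeff (Finsupp.single i 1) := by
  ext x
  simp [polyFun, linForm, homogeneousComponent_one_eq]

lemma polyFun_lowPart_zero (a : Fin N → ℝ) (P : MvPolynomial (Fin N) ℝ) :
    polyFun a (lowPart 0 P) = fun _ => P.coeff 0 := by
  ext x
  simp [polyFun, lowPart, MvPolynomial.homogeneousComponent_zero]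

lemma polyFun_sub (a : Fin N → ℝ) (P R : MvPolynomial (Fin N) ℝ) :
    polyFun a (P - R) = polyFun a P - polyFun a R := by
  ext x; simp [polyFun]

lemma polyFun_lowPart_one (a : Fin N → ℝ) (P : MvPolynomial (Fin N) ℝ) :
    polyFun a (lowPart 1 P)
      = (fun _ => P.coeff 0) + linForm a fun i => P.coeff (Finsupp.single i 1) := by
  rw [← polyFun_homogeneousComponent_one, ← polyFun_lowPart_zero a P]
  ext x
  simp [polyFun, lowPart, Finset.sum_range_succ]

/-! ### Real-valued L^p norms. -/

/-- `‖f‖_{L^p(Ω)}` as a real number. -/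
def rnorm (p : ℝ) (Ω : Set (Fin N → ℝ)) (f : (Fin N → ℝ) → ℝ) : ℝ := (lpNorm p Ω f).toReal

/-- Membership in `L^p(Ω)`. -/
abbrev InLp (p : ℝ) (Ω : Set (Fin N → ℝ)) (f : (Fin N → ℝ) → ℝ) : Prop :=
  MemLp f (ENNReal.ofReal p) (volume.restrict Ω)

lemma one_le_ofReal {p : ℝ} (hp : 1 ≤ p) : 1 ≤ ENNReal.ofReal p := by
  simpa using ENNReal.ofReal_le_ofReal hp

lemma rnorm_nonneg (p : ℝ) (Ω : Set (Fin N → ℝ)) (f : (Fin N → ℝ) → ℝ) : 0 ≤ rnorm p Ω f :=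
  ENNReal.toReal_nonneg

lemma InLp.lpNorm_ne_top {p : ℝ} {Ω : Set (Fin N → ℝ)} {f : (Fin N → ℝ) → ℝ} (hf : InLp p Ω f) :
    lpNorm p Ω f ≠ ⊤ :=
  hf.eLpNorm_ne_top

lemma InLp.lpNorm_eq {p : ℝ} {Ω : Set (Fin N → ℝ)} {f : (Fin N → ℝ) → ℝ} (hf : InLp p Ω f) :
    lpNorm p Ω f = ENNReal.ofReal (rnorm p Ω f) :=
  (ENNReal.ofReal_toReal hf.lpNorm_ne_top).symm

lemma rnorm_add_le {p : ℝ} (hp : 1 ≤ p) {Ω : Set (Fin N → ℝ)} {f g : (Fin N → ℝ) → ℝ}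
    (hf : InLp p Ω f) (hg : InLp p Ω g) : rnorm p Ω (f + g) ≤ rnorm p Ω f + rnorm p Ω g := by
  unfold rnorm
  rw [← ENNReal.toReal_add hf.lpNorm_ne_top hg.lpNorm_ne_top]
  exact ENNReal.toReal_mono (ENNReal.add_ne_top.2 ⟨hf.lpNorm_ne_top, hg.lpNorm_ne_top⟩)
    (eLpNorm_add_le hf.1 hg.1 (one_le_ofReal hp))

lemma rnorm_mono {p : ℝ} {Ω : Set (Fin N → ℝ)} {f g : (Fin N → ℝ) → ℝ} (hg : InLp p Ω g)
    (h : ∀ᵐ x ∂(volume.restrict Ω), |f x| ≤ |g x|) : rnorm p Ω f ≤ rnorm p Ω g :=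
  ENNReal.toReal_mono hg.lpNorm_ne_top (eLpNorm_mono_ae h)

lemma rnorm_one {Ω : Set (Fin N → ℝ)} {f : (Fin N → ℝ) → ℝ} (hf : InLp 1 Ω f) :
    rnorm 1 Ω f = ∫ x in Ω, |f x| := by
  unfold rnorm lpNorm
  rw [ENNReal.ofReal_one, eLpNorm_one_eq_lintegral_enorm]
  exact (integral_norm_eq_lintegral_enorm hf.1).symm

/-! ### Linear forms under reflection in the centre of the cube. -/

lemma continuous_linForm (a l : Fin N → ℝ) : Continuous (linForm a l) := by
  unfold linForm; fun_prop

/-- Reflection in the centre of the cube preserves Lebesgue measure on the cube. -/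
lemma measurePreserving_reflect_cube (a : Fin N → ℝ) (ℓ : ℝ) :
    MeasurePreserving (fun x => (a + a) - x) (volume.restrict (cube a ℓ))
      (volume.restrict (cube a ℓ)) := by
  have h := (volume.measurePreserving_sub_left (a + a)).restrict_preimage
    (isOpen_cube a ℓ).measurableSet
  have h2 : (fun x => (a + a) - x) ⁻¹' cube a ℓ = cube a ℓ := by
    ext x
    simp only [cube, Set.mem_preimage, Set.mem_ofPred_eq, Pi.sub_apply, Pi.add_apply]
    refine forall_congr' fun i => ?_
    rw [show a i + a i - x i - a i = -(x i - a i) by ring, abs_neg]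
  rwa [h2] at h

lemma linForm_reflect (a l x : Fin N → ℝ) : linForm a l ((a + a) - x) = - linForm a l x := by
  simp only [linForm, Pi.sub_apply, Pi.add_apply, ← Finset.sum_neg_distrib]
  exact Finset.sum_congr rfl fun i _ => by ring

/-- The negative part of a linear form about the centre of a cube carries half of the `p`-th power
of its `L^p` norm. -/
lemma rnorm_linForm_neg {p : ℝ} (hp : 1 ≤ p) (a l : Fin N → ℝ) (ℓ : ℝ) :
    rnorm p (cube a ℓ) (fun x => max (-linForm a l x) 0)
      = 2 ^ (-(1 / p)) * rnorm p (cube a ℓ) (linForm a l) := by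
  have hp0 : 0 < p := by linarith
  have hpne : ENNReal.ofReal p ≠ 0 := by simpa using hp0
  have hr : (ENNReal.ofReal p).toReal = p := ENNReal.toReal_ofReal hp0.le
  set μ := volume.restrict (cube a ℓ)
  have hs := continuous_linForm a l
  have hneg : Continuous fun x => max (-linForm a l x) 0 := by fun_prop
  have hpos : Continuous fun x => max (linForm a l x) 0 := by fun_prop
  -- The reflection changes the sign of the form, so it exchanges the positive and the negative
  -- part.
  have e1 : ∫⁻ x, ‖max (linForm a l x) 0‖ₑ ^ p ∂μ = ∫⁻ x, ‖max (-linForm a l x) 0‖ₑ ^ p ∂μ := by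
    rw [← (measurePreserving_reflect_cube a ℓ).lintegral_comp
      (f := fun x => ‖max (-linForm a l x) 0‖ₑ ^ p) (by fun_prop)]
    simp [linForm_reflect, μ]
  have e2 : ∫⁻ x, ‖linForm a l x‖ₑ ^ p ∂μ = 2 * ∫⁻ x, ‖max (-linForm a l x) 0‖ₑ ^ p ∂μ := by
    have h3 : ∀ x, ‖linForm a l x‖ₑ ^ p
        = ‖max (linForm a l x) 0‖ₑ ^ p + ‖max (-linForm a l x) 0‖ₑ ^ p := by
      intro x
      rcases le_total 0 (linForm a l x) with h | h
      · rw [max_eq_left h, max_eq_right (by linarith)]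
        simp [hp0]
      · rw [max_eq_right h, max_eq_left (by linarith)]
        simp [hp0]
    simp_rw [h3]
    rw [lintegral_add_left (by fun_prop), e1, two_mul]
  have key : lpNorm p (cube a ℓ) (linForm a l)
      = 2 ^ (1 / p) * lpNorm p (cube a ℓ) (fun x => max (-linForm a l x) 0) := by
    unfold lpNorm
    rw [eLpNorm_eq_lintegral_rpow_enorm_toReal hpne ENNReal.ofReal_ne_top,
      eLpNorm_eq_lintegral_rpow_enorm_toReal hpne ENNReal.ofReal_ne_top, hr, e2,
      ENNReal.mul_rpow_of_nonneg _ _ (by positivity)]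
  have key2 : rnorm p (cube a ℓ) (linForm a l)
      = 2 ^ (1 / p) * rnorm p (cube a ℓ) (fun x => max (-linForm a l x) 0) := by
    unfold rnorm
    rw [key, ENNReal.toReal_mul, ← ENNReal.toReal_rpow, ENNReal.toReal_ofNat]
  rw [key2, ← mul_assoc, ← Real.rpow_add (by norm_num)]
  simp

/-! ### Distance from a nonnegative function to a linear form. -/

/-- Where s < 0, the error u - s is the sum of the two nonnegative quantities u and -s. For p > 1
only the resulting lower bound by s⁻ is used; for p = 1 the exact equality identifies the excess of
the error over ‖s⁻‖ with the distance to s⁺. -/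
lemma abs_sub_eq_of_nonneg {u s : ℝ} (hu : 0 ≤ u) : |u - s| = |u - max s 0| + max (-s) 0 := by
  rcases le_total 0 s with h | h
  · rw [max_eq_left h, max_eq_right (by linarith), add_zero]
  · rw [max_eq_right h, max_eq_left (by linarith), sub_zero, abs_of_nonneg hu,
      abs_of_nonneg (by linarith)]
    ring

/-- If the constant part of an approximant `f = b + s + R` is small compared with `s`, then `f` and
the approximated function `u` are controlled through `s`. -/
lemma rnorm_sub_le_of_small_const {p : ℝ} (hp : 1 ≤ p) {Ω : Set (Fin N → ℝ)}
    {u f b s : (Fin N → ℝ) → ℝ} (hu : InLp p Ω u) (hf : InLp p Ω f) (hb : InLp p Ω b)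
    (hs : InLp p Ω s) {δ α : ℝ} (hδ : 0 < δ) (hδ1 : δ ≤ 1) (hα : 2 / δ ≤ α)
    (h1 : α * rnorm p Ω (f - (b + s)) ≤ rnorm p Ω (b + s))
    (h2 : rnorm p Ω (u - f) ≤ 2⁻¹ * rnorm p Ω f) (h3 : rnorm p Ω b ≤ δ * rnorm p Ω s) :
    rnorm p Ω (f - s) ≤ 2 * δ * rnorm p Ω s ∧
      rnorm p Ω (u - s) ≤ (1 / 2 + 3 * δ) * rnorm p Ω s := by
  have hbs : rnorm p Ω (b + s) ≤ rnorm p Ω b + rnorm p Ω s := rnorm_add_le hp hb hs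
  have hfs : rnorm p Ω (f - s) ≤ rnorm p Ω (f - (b + s)) + rnorm p Ω b := by
    have := rnorm_add_le hp (hf.sub (hb.add hs)) hb
    rwa [show f - (b + s) + b = f - s by abel] at this
  have hff : rnorm p Ω f ≤ rnorm p Ω (f - s) + rnorm p Ω s := by
    have := rnorm_add_le hp (hf.sub hs) hs
    rwa [sub_add_cancel] at this
  have hus : rnorm p Ω (u - s) ≤ rnorm p Ω (u - f) + rnorm p Ω (f - s) := by
    have := rnorm_add_le hp (hu.sub hf) (hf.sub hs)
    rwa [sub_add_sub_cancel] at this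
  have n0 := rnorm_nonneg p Ω (f - (b + s))
  have n1 := rnorm_nonneg p Ω s
  have hR : rnorm p Ω (f - (b + s)) ≤ δ * rnorm p Ω s := by
    -- With R = f - (b + s): (2/δ)‖R‖ ≤ ‖b + s‖ ≤ (1 + δ)‖s‖ ≤ 2‖s‖.
    have h4 : 2 / δ * rnorm p Ω (f - (b + s)) ≤ 2 * rnorm p Ω s := by
      have := mul_le_mul_of_nonneg_right hα n0
      nlinarith
    rw [div_mul_eq_mul_div, div_le_iff₀ hδ] at h4
    linarith
  -- The second constant is (1 + 2δ)/2 + 2δ, from ‖u - f‖ ≤ ‖f‖/2 and ‖f‖ ≤ (1 + 2δ)‖s‖.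
  constructor <;> linarith

lemma InLp.integrableOn {Ω : Set (Fin N → ℝ)} {f : (Fin N → ℝ) → ℝ} (hf : InLp 1 Ω f) :
    IntegrableOn f Ω := by
  rw [InLp, ENNReal.ofReal_one] at hf
  exact memLp_one_iff_integrable.1 hf

/-- A nonnegative function whose `L¹` distance to a linear form is almost minimal is close to the
positive part of the form. -/
lemma rnorm_one_sub_posPart {a l : Fin N → ℝ} {ℓ : ℝ} {u : (Fin N → ℝ) → ℝ}
    (hu : InLp 1 (cube a ℓ) u) (hu0 : ∀ᵐ x ∂(volume.restrict (cube a ℓ)), 0 ≤ u x) :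
    rnorm 1 (cube a ℓ) (u - fun x => max (linForm a l x) 0)
      = rnorm 1 (cube a ℓ) (u - linForm a l) - 1 / 2 * rnorm 1 (cube a ℓ) (linForm a l) := by
  have hs := continuous_linForm a l
  have hpos : InLp 1 (cube a ℓ) fun x => max (linForm a l x) 0 := memLp_cube 1 a ℓ (by fun_prop)
  have hneg : InLp 1 (cube a ℓ) fun x => max (-linForm a l x) 0 := memLp_cube 1 a ℓ (by fun_prop)
  have hsm : InLp 1 (cube a ℓ) (linForm a l) := memLp_cube 1 a ℓ hs
  have h := rnorm_linForm_neg le_rfl a l ℓ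
  rw [div_one, Real.rpow_neg_one, rnorm_one hneg] at h
  rw [one_div, ← h, rnorm_one (hu.sub hpos), rnorm_one (hu.sub hsm), eq_sub_iff_add_eq]
  have i1 := InLp.integrableOn (hu.sub hpos)
  have i2 := InLp.integrableOn hneg
  rw [← integral_add i1.abs i2.abs]
  refine integral_congr_ae ?_
  filter_upwards [hu0] with x hx
  simp only [Pi.sub_apply]
  rw [abs_sub_eq_of_nonneg (s := linForm a l x) hx, abs_of_nonneg (le_max_right (-linForm a l x) 0)]

/-- The negative part of a linear form is dominated by its distance to a nonnegative function. -/
lemma rnorm_linForm_le_of_nonneg {p : ℝ} (hp : 1 ≤ p) {a l : Fin N → ℝ} {ℓ : ℝ}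
    {u : (Fin N → ℝ) → ℝ} (hu : InLp p (cube a ℓ) u)
    (hu0 : ∀ᵐ x ∂(volume.restrict (cube a ℓ)), 0 ≤ u x) :
    2 ^ (-(1 / p)) * rnorm p (cube a ℓ) (linForm a l) ≤ rnorm p (cube a ℓ) (u - linForm a l) := by
  rw [← rnorm_linForm_neg hp]
  refine rnorm_mono (hu.sub (memLp_cube p a ℓ (continuous_linForm a l))) ?_
  filter_upwards [hu0] with x hx
  rw [Pi.sub_apply, abs_sub_eq_of_nonneg (s := linForm a l x) hx,
    abs_of_nonneg (le_max_right (-linForm a l x) 0)]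
  linarith [abs_nonneg (u x - max (linForm a l x) 0)]

/-! ### Volumes of cubes and slabs, and the L¹ gain of a competitor. -/

lemma cube_eq_pi (a : Fin N → ℝ) (ℓ : ℝ) :
    cube a ℓ = Set.univ.pi fun i => Set.Ioo (a i - ℓ / 2) (a i + ℓ / 2) := by
  ext x
  simp only [cube, Set.mem_ofPred_eq, Set.mem_pi, Set.mem_univ, true_imp_iff, Set.mem_Ioo,
    abs_lt]
  refine forall_congr' fun i => ⟨fun h => ⟨by linarith, by linarith⟩,
    fun h => ⟨by linarith, by linarith⟩⟩

lemma volume_cube (a : Fin N → ℝ) {ℓ : ℝ} (hℓ : 0 < ℓ) :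
    volume (cube a ℓ) = ENNReal.ofReal (ℓ ^ N) := by
  rw [cube_eq_pi, Real.volume_pi_Ioo, ENNReal.ofReal_pow hℓ.le]
  simp only [add_sub_sub_cancel, add_halves, Finset.prod_const, Finset.card_univ, Fintype.card_fin]

lemma volume_real_cube (a : Fin N → ℝ) {ℓ : ℝ} (hℓ : 0 < ℓ) :
    volume.real (cube a ℓ) = ℓ ^ N := by
  rw [Measure.real, volume_cube a hℓ, ENNReal.toReal_ofReal (by positivity)]

lemma volume_cube_lt_top (a : Fin N → ℝ) {ℓ : ℝ} (hℓ : 0 < ℓ) : volume (cube a ℓ) < ⊤ := by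
  rw [volume_cube a hℓ]; exact ENNReal.ofReal_lt_top

lemma abs_linForm_le {a l x : Fin N → ℝ} {ℓ K : ℝ} (hK : ∀ i, |l i| ≤ K) (hx : x ∈ cube a ℓ) :
    |linForm a l x| ≤ N * (K * (ℓ / 2)) := by
  refine (Finset.abs_sum_le_sum_abs _ _).trans ?_
  have : ∀ i ∈ (Finset.univ : Finset (Fin N)), |l i * (x i - a i)| ≤ K * (ℓ / 2) := fun i _ => by
    rw [abs_mul]
    exact mul_le_mul (hK i) (hx i).le (abs_nonneg _) ((abs_nonneg _).trans (hK i))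
  simpa using Finset.sum_le_card_nsmul _ _ _ this

lemma rnorm_one_le_of_bound {a : Fin N → ℝ} {ℓ C : ℝ} (hℓ : 0 < ℓ) {f : (Fin N → ℝ) → ℝ}
    (hf : InLp 1 (cube a ℓ) f) (h : ∀ x ∈ cube a ℓ, |f x| ≤ C) :
    rnorm 1 (cube a ℓ) f ≤ C * ℓ ^ N := by
  rw [rnorm_one hf, ← volume_real_cube a hℓ]
  refine (le_abs_self _).trans ?_
  exact norm_setIntegral_le_of_norm_le_const (f := fun x => |f x|) (volume_cube_lt_top a hℓ)
    (fun x hx => by simpa using h x hx)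

/-- The measure of a slab of a cube. -/
lemma volume_slab_le {a l : Fin N → ℝ} {ℓ : ℝ} (hℓ : 0 < ℓ) {i : Fin N} (hi : l i ≠ 0) :
    volume.real {x ∈ cube a ℓ | |linForm a l x| < |l i| * ℓ / 8} ≤ ℓ ^ N / 4 := by
  -- Replacing the i-th coordinate of x - a by the value of the form is a linear map of determinant
  -- `l i`. It carries the slab into the box `B`, whose volume is then divided by |l i|.
  set A : Matrix (Fin N) (Fin N) ℝ := (1 : Matrix (Fin N) (Fin N) ℝ).updateRow i l
  have hdet : LinearMap.det (Matrix.toLin' A) = l i := by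
    rw [LinearMap.det_toLin', ← Matrix.cramer_transpose_apply, Matrix.transpose_one,
      Matrix.cramer_one]
    rfl
  set B : Set (Fin N → ℝ) := Set.univ.pi fun j =>
    Set.Ioo (-(if j = i then |l i| * ℓ / 8 else ℓ / 2)) (if j = i then |l i| * ℓ / 8 else ℓ / 2)
  have hvol : volume B = ENNReal.ofReal (|l i| / 4 * ℓ ^ N) := by
    rw [Real.volume_pi_Ioo, ← ENNReal.ofReal_prod_of_nonneg]
    · congr 1
      have : ∀ j, ((if j = i then |l i| * ℓ / 8 else ℓ / 2)
          - -(if j = i then |l i| * ℓ / 8 else ℓ / 2)) = (if j = i then |l i| / 4 else 1) * ℓ := by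
        intro j; split_ifs <;> ring
      simp only [this, Finset.prod_mul_distrib, Finset.prod_ite_eq', Finset.mem_univ, if_true,
        Finset.prod_const, Finset.card_univ, Fintype.card_fin]
    · intro j _
      split_ifs <;> linarith [mul_nonneg (abs_nonneg (l i)) hℓ.le]
  have hsub : {x ∈ cube a ℓ | |linForm a l x| < |l i| * ℓ / 8}
      ⊆ (fun x => x - a) ⁻¹' (Matrix.toLin' A ⁻¹' B) := by
    rintro x ⟨hx, hx2⟩
    simp only [Set.mem_preimage, B, Set.mem_pi, Set.mem_univ, true_imp_iff, Set.mem_Ioo,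
      ← abs_lt]
    intro j
    by_cases hj : j = i
    · subst hj
      rw [if_pos rfl]
      have e : Matrix.toLin' A (x - a) j = linForm a l x := by
        simp [A, Matrix.mulVec, dotProduct, linForm]
      rwa [e]
    · rw [if_neg hj]
      have e : Matrix.toLin' A (x - a) j = x j - a j := by
        simp [A, Matrix.mulVec, Matrix.updateRow_ne hj, Matrix.one_apply, dotProduct]
      rw [e]
      exact hx j
  have hle : volume {x ∈ cube a ℓ | |linForm a l x| < |l i| * ℓ / 8}
      ≤ ENNReal.ofReal (ℓ ^ N / 4) := by
    refine (measure_mono hsub).trans (le_of_eq ?_)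
    simp only [sub_eq_add_neg]
    rw [measure_preimage_add_right, Measure.addHaar_preimage_linearMap _ (by rwa [hdet]), hdet,
      hvol, ← ENNReal.ofReal_mul (abs_nonneg _), abs_inv]
    congr 1
    have : |l i| ≠ 0 := abs_ne_zero.2 hi
    field_simp
  exact ENNReal.toReal_le_of_le_ofReal (by positivity) hle

/-- Half of a linear form plus a suitable constant approximates the positive part of the form in
`L¹` strictly better than the form itself. -/
lemma integral_abs_half_sub_le {a l : Fin N → ℝ} {ℓ : ℝ} (hℓ : 0 < ℓ) {i : Fin N} (hi : l i ≠ 0) :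
    ∫ x in cube a ℓ, |(|linForm a l x| / 2 - |l i| * ℓ / 16)|
      ≤ 1 / 2 * rnorm 1 (cube a ℓ) (linForm a l) - |l i| * ℓ / 32 * ℓ ^ N := by
  set c := |l i| * ℓ / 16 with hc
  have hc0 : 0 < c := by have := abs_pos.2 hi; positivity
  have hs := continuous_linForm a l
  set S := {x ∈ cube a ℓ | |linForm a l x| < |l i| * ℓ / 8}
  have hS : MeasurableSet S :=
    (isOpen_cube a ℓ).measurableSet.inter (isOpen_lt hs.abs continuous_const).measurableSet
  have hSf : volume S < ⊤ := (measure_mono fun x hx => hx.1).trans_lt (volume_cube_lt_top a hℓ)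
  have hfin : IsFiniteMeasure (volume.restrict (cube a ℓ)) :=
    ⟨by rw [Measure.restrict_apply_univ]; exact volume_cube_lt_top a hℓ⟩
  have hint : ∀ f : (Fin N → ℝ) → ℝ, Continuous f → IntegrableOn f (cube a ℓ) := fun f hf =>
    InLp.integrableOn (memLp_cube 1 a ℓ hf)
  have hind : IntegrableOn (S.indicator fun _ => 2 * c) (cube a ℓ) :=
    (integrable_const _).indicator hS
  -- The slab `S` is where |s|/2 < c, and |y - c| ≤ (y - c) + 2c·1_{y < c} for y ≥ 0. Since `S`
  -- fills at most a quarter of the cube, subtracting c saves at least c - 2c/4 = c/2 per unit of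
  -- volume.
  have h1 : ∫ x in cube a ℓ, |(|linForm a l x| / 2 - c)|
      ≤ ∫ x in cube a ℓ, ((|linForm a l x| / 2 - c) + S.indicator (fun _ => 2 * c) x) := by
    refine setIntegral_mono_on (hint _ (by fun_prop)) ((hint _ (by fun_prop)).add hind)
      (isOpen_cube a ℓ).measurableSet fun x hx => ?_
    by_cases hxS : x ∈ S
    · rw [Set.indicator_of_mem hxS]
      refine abs_le.2 ⟨?_, ?_⟩ <;> linarith [abs_nonneg (linForm a l x)]
    · rw [Set.indicator_of_notMem hxS, add_zero]
      have : |l i| * ℓ / 8 ≤ |linForm a l x| := not_lt.1 fun h => hxS ⟨hx, h⟩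
      rw [abs_of_nonneg (by linarith)]
  have h2 : ∫ x in cube a ℓ, S.indicator (fun _ => 2 * c) x = volume.real S * (2 * c) := by
    rw [integral_indicator_const _ hS, smul_eq_mul, measureReal_restrict_apply hS,
      Set.inter_eq_left.2 fun x hx => hx.1]
  rw [integral_add (hint _ (by fun_prop)) hind, h2,
    integral_sub (hint _ (by fun_prop)) (hint _ (by fun_prop)), setIntegral_const, smul_eq_mul,
    volume_real_cube a hℓ, integral_div,
    ← rnorm_one (memLp_cube 1 a ℓ hs)] at h1
  have h3 := volume_slab_le (a := a) (l := l) hℓ hi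
  have h4 := mul_le_mul_of_nonneg_right h3 (by linarith : 0 ≤ 2 * c)
  refine h1.trans ?_
  have : |l i| * ℓ / 32 = c / 2 := by rw [hc]; ring
  rw [this]
  linarith

/-! ### Derivatives of affine functions and their effect on gradient norms. -/

lemma partialD_const (i : Fin N) (k : ℝ) : partialD i (fun _ => k) = fun _ => 0 := by
  ext x; simp [partialD]

lemma partialD_affine (i : Fin N) (a l : Fin N → ℝ) (k : ℝ) :
    partialD i (fun x => k + linForm a l x) = fun _ => l i := by
  ext x
  have h : HasFDerivAt (fun x => k + linForm a l x)
      (∑ j, l j • (ContinuousLinearMap.proj j : (Fin N → ℝ) →L[ℝ] ℝ)) x := by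
    refine HasFDerivAt.const_add k (HasFDerivAt.fun_sum fun j _ => ?_)
    exact ((hasFDerivAt_apply j x).sub_const (a j)).const_mul (l j)
  rw [partialD, h.fderiv]
  simp [Pi.single_apply]

lemma partialD_iter_const (i : Fin N) (n : ℕ) (k : ℝ) :
    (partialD i)^[n] (fun _ => k) = fun _ => if n = 0 then k else 0 := by
  induction n generalizing k with
  | zero => simp
  | succ n ih => rw [Function.iterate_succ_apply, partialD_const, ih]; simp

lemma foldl_partialD_const (γ : Fin N → ℕ) (L : List (Fin N)) (k : ℝ) :
    L.foldl (fun g i => (partialD i)^[γ i] g) (fun _ => k)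
      = fun _ => if (L.map γ).sum = 0 then k else 0 := by
  induction L generalizing k with
  | nil => simp
  | cons i L ih =>
    rw [List.foldl_cons, partialD_iter_const, ih]
    by_cases h : γ i = 0 <;> simp [h]

/-- The first derivative taken turns the affine function into the constant `l i`; any further
derivative, in the same or a later direction, annihilates it. -/
lemma foldl_partialD_affine (γ : Fin N → ℕ) (L : List (Fin N)) (a l : Fin N → ℝ) (k : ℝ) {K : ℝ}
    (hK : ∀ i, |l i| ≤ K) (hK0 : 0 ≤ K) (hL : 1 ≤ (L.map γ).sum) :
    ∃ k', L.foldl (fun g i => (partialD i)^[γ i] g) (fun x => k + linForm a l x) = (fun _ => k') ∧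
      |k'| ≤ K ∧ (2 ≤ (L.map γ).sum → k' = 0) := by
  induction L with
  | nil => simp at hL
  | cons i L ih =>
    rw [List.foldl_cons, List.map_cons, List.sum_cons]
    rcases h : γ i with _ | n
    · rw [List.map_cons, List.sum_cons, h, zero_add] at hL
      simpa using ih hL
    · rw [Function.iterate_succ_apply, partialD_affine, partialD_iter_const, foldl_partialD_const]
      refine ⟨_, rfl, ?_, fun h2 => ?_⟩
      · split_ifs
        · exact hK i
        all_goals simpa using hK0
      · split_ifs
        · omega
        all_goals rfl

lemma revD_affine {γ : Fin N → ℕ} {a l : Fin N → ℝ} {K : ℝ} (k : ℝ) (hK : ∀ i, |l i| ≤ K)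
    (hK0 : 0 ≤ K) (hγ : 1 ≤ ∑ i, γ i) :
    ∃ k', revD γ (fun x => k + linForm a l x) = (fun _ => k') ∧ |k'| ≤ K ∧
      (2 ≤ ∑ i, γ i → k' = 0) := by
  have h : ((List.finRange N).map γ).sum = ∑ i, γ i := by rw [← List.ofFn_eq_map, List.sum_ofFn]
  rw [← h] at hγ ⊢
  exact foldl_partialD_affine γ _ a l k hK hK0 hγ

lemma contDiff_affine (a l : Fin N → ℝ) (k : ℝ) : ContDiff ℝ ∞ fun x => k + linForm a l x := by
  unfold linForm; fun_prop

lemma lpNorm_one_const (a : Fin N → ℝ) {ℓ : ℝ} (hℓ : 0 < ℓ) (k : ℝ) :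
    lpNorm 1 (cube a ℓ) (fun _ => k) = ENNReal.ofReal (|k| * ℓ ^ N) := by
  unfold lpNorm
  rw [ENNReal.ofReal_one, eLpNorm_one_eq_lintegral_enorm, lintegral_const,
    Measure.restrict_apply_univ, volume_cube a hℓ, Real.enorm_eq_ofReal_abs,
    ENNReal.ofReal_mul (abs_nonneg k)]

/-- Subtracting an affine function changes only the first order term among the terms of positive
order. -/
lemma gradNorm_sub_affine_le {a l : Fin N → ℝ} {ℓ K : ℝ} (hℓ : 0 < ℓ) (k : ℝ)
    (hK : ∀ i, |l i| ≤ K) (hK0 : 0 ≤ K) {i : ℕ} {g : (Fin N → ℝ) → ℝ}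
    (hg : ∀ γ : Fin N → ℕ, ∑ j, γ j = i + 1 → ∃ v, HasWeakDeriv (cube a ℓ) γ g v ∧
      InLp 1 (cube a ℓ) v) :
    gradNorm (i + 1) 1 (cube a ℓ) (g - fun x => k + linForm a l x)
      ≤ gradNorm (i + 1) 1 (cube a ℓ) g + if i = 0 then
        (Finset.piAntidiag (Finset.univ : Finset (Fin N)) 1).card * ENNReal.ofReal (K * ℓ ^ N)
        else 0 := by
  have key : ∀ γ ∈ Finset.piAntidiag (Finset.univ : Finset (Fin N)) (i + 1),
      lpNorm 1 (cube a ℓ) (weakDeriv (cube a ℓ) γ (g - fun x => k + linForm a l x))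
        ≤ lpNorm 1 (cube a ℓ) (weakDeriv (cube a ℓ) γ g)
          + if i = 0 then ENNReal.ofReal (K * ℓ ^ N) else 0 := by
    intro γ hγ
    have hγ1 : ∑ j, γ j = i + 1 := (Finset.mem_piAntidiag.1 hγ).1
    obtain ⟨v, hv, hvm⟩ := hg γ hγ1
    obtain ⟨k', hk', hk'K, hk'0⟩ :=
      revD_affine (γ := γ) (a := a) k hK hK0 (by rw [hγ1]; omega)
    have hw := hv.sub (isOpen_cube a ℓ)
      (hasWeakDeriv_of_contDiff (cube a ℓ) γ (contDiff_affine a l k))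
    rw [hk'] at hw
    have hk : InLp 1 (cube a ℓ) fun _ => k' := memLp_cube 1 a ℓ continuous_const
    have h1 : lpNorm 1 (cube a ℓ) (weakDeriv (cube a ℓ) γ (g - fun x => k + linForm a l x))
        ≤ lpNorm 1 (cube a ℓ) v + lpNorm 1 (cube a ℓ) fun _ => k' := by
      rw [lpNorm, eLpNorm_congr_ae (hw.weakDeriv_ae_eq (isOpen_cube a ℓ))]
      exact eLpNorm_sub_le hvm.1 hk.1 (by simp)
    have h2 : lpNorm 1 (cube a ℓ) (weakDeriv (cube a ℓ) γ g) = lpNorm 1 (cube a ℓ) v :=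
      eLpNorm_congr_ae (hv.weakDeriv_ae_eq (isOpen_cube a ℓ))
    rw [h2]
    refine h1.trans ?_
    gcongr
    rw [lpNorm_one_const a hℓ]
    split_ifs with h
    · exact ENNReal.ofReal_le_ofReal (by gcongr)
    · rw [hk'0 (by omega)]; simp
  refine (Finset.sum_le_sum key).trans ?_
  rw [Finset.sum_add_distrib, Finset.sum_const, nsmul_eq_mul]
  refine add_le_add le_rfl ?_
  split_ifs with h
  · subst h; rfl
  · simp

/-! ### Minimality of the projection and the bound on the side of the cube. -/

lemma hasWeakDeriv_zero {Ω : Set (Fin N → ℝ)} {u : (Fin N → ℝ) → ℝ}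
    (hu : LocallyIntegrableOn u Ω) : HasWeakDeriv Ω 0 u u := by
  refine ⟨hu, hu, fun φ _ _ _ => ?_⟩
  have : multiD (0 : Fin N → ℕ) φ = φ := by
    simp [multiD]
  rw [this]; simp

/-- `weakDeriv` chooses a representative even at order zero, so it agrees with u only almost
everywhere. -/
lemma gradNorm_zero {p : ℝ} {Ω : Set (Fin N → ℝ)} (hΩ : IsOpen Ω) {u : (Fin N → ℝ) → ℝ}
    (hu : LocallyIntegrableOn u Ω) : gradNorm 0 p Ω u = lpNorm p Ω u := by
  rw [gradNorm, Finset.piAntidiag_zero, Finset.sum_singleton]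
  exact eLpNorm_congr_ae ((hasWeakDeriv_zero hu).weakDeriv_ae_eq hΩ)

/-- Minimality of the approximation error in `W^{r,1}`, tested against affine perturbations. -/
lemma rnorm_le_of_minimal {r : ℕ} (hr : 1 ≤ r) {a l : Fin N → ℝ} {ℓ K : ℝ} (hℓ : 0 < ℓ) (k : ℝ)
    (hK : ∀ i, |l i| ≤ K) (hK0 : 0 ≤ K) {u : (Fin N → ℝ) → ℝ}
    (hu : u ∈ sobolev (r + 1) 1 (cube a ℓ)) {P : MvPolynomial (Fin N) ℝ} (hP : P.totalDegree ≤ r)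
    (hmin : ∀ R : MvPolynomial (Fin N) ℝ, R.totalDegree ≤ r →
      approxError r 1 a ℓ u P ≤ approxError r 1 a ℓ u R) :
    rnorm 1 (cube a ℓ) (u - polyFun a P)
      ≤ rnorm 1 (cube a ℓ) (u - polyFun a P - fun x => k + linForm a l x)
        + (Finset.piAntidiag (Finset.univ : Finset (Fin N)) 1).card * (K * ℓ ^ N) := by
  -- The competitor is P + q; it is admissible because 1 ≤ r leaves room for affine terms.
  set q : MvPolynomial (Fin N) ℝ := MvPolynomial.C k + ∑ i, MvPolynomial.C (l i) * MvPolynomial.X i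
  have hq : polyFun a q = fun x => k + linForm a l x := by
    ext x; simp [q, polyFun, linForm]
  have hqd : q.totalDegree ≤ r := by
    refine (MvPolynomial.totalDegree_add _ _).trans (max_le (by simp) ?_)
    refine MvPolynomial.totalDegree_finsetSum_le fun i _ => ?_
    refine (MvPolynomial.totalDegree_mul _ _).trans ?_
    simpa using hr
  have hfun : u - polyFun a (P + q) = u - polyFun a P - fun x => k + linForm a l x := by
    have : polyFun a (P + q) = polyFun a P + polyFun a q := by
      ext x; simp [polyFun]
    rw [this, hq, sub_sub]
  have hum : InLp 1 (cube a ℓ) u := hu.1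
  have hPm : InLp 1 (cube a ℓ) (polyFun a P) := memLp_cube 1 a ℓ (contDiff_polyFun a P).continuous
  have hqm : InLp 1 (cube a ℓ) (fun x => k + linForm a l x) :=
    memLp_cube 1 a ℓ (contDiff_affine a l k).continuous
  have hg : ∀ γ : Fin N → ℕ, ∑ j, γ j ≤ r + 1 → ∃ v, HasWeakDeriv (cube a ℓ) γ (u - polyFun a P) v
      ∧ InLp 1 (cube a ℓ) v := by
    intro γ hγ
    obtain ⟨v, hv, hvm⟩ := hu.2 γ hγ
    exact ⟨_, hv.sub (isOpen_cube a ℓ) (hasWeakDeriv_of_contDiff _ γ (contDiff_polyFun a P)),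
      hvm.sub (memLp_cube 1 a ℓ (contDiff_revD γ (contDiff_polyFun a P)).continuous)⟩
  have h := hmin (P + q) ((MvPolynomial.totalDegree_add _ _).trans (max_le hP hqd))
  unfold approxError at h
  rw [hfun, Finset.sum_range_succ', Finset.sum_range_succ',
    gradNorm_zero (isOpen_cube a ℓ) (InLp.integrableOn (hum.sub hPm)).locallyIntegrableOn,
    gradNorm_zero (isOpen_cube a ℓ)
      (InLp.integrableOn ((hum.sub hPm).sub hqm)).locallyIntegrableOn] at h
  set S := ∑ i ∈ Finset.range r, gradNorm (i + 1) 1 (cube a ℓ) (u - polyFun a P) with hS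
  set E : ℝ≥0∞ :=
    (Finset.piAntidiag (Finset.univ : Finset (Fin N)) 1).card * ENNReal.ofReal (K * ℓ ^ N)
  -- Finiteness of the positive-order part allows it to be cancelled from the minimality inequality
  -- in `ℝ≥0∞`.
  have hStop : S ≠ ⊤ := by
    refine ENNReal.sum_ne_top.2 fun i hi => ENNReal.sum_ne_top.2 fun γ hγ => ?_
    have h1 : ∑ j, γ j = i + 1 := (Finset.mem_piAntidiag.1 hγ).1
    obtain ⟨v, hv, hvm⟩ := hg γ (by have := Finset.mem_range.1 hi; omega)
    rw [lpNorm, eLpNorm_congr_ae (hv.weakDeriv_ae_eq (isOpen_cube a ℓ))]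
    exact hvm.lpNorm_ne_top
  have h2 : ∑ i ∈ Finset.range r, gradNorm (i + 1) 1 (cube a ℓ)
      (u - polyFun a P - fun x => k + linForm a l x) ≤ S + E := by
    refine (Finset.sum_le_sum fun i hi => gradNorm_sub_affine_le hℓ k hK hK0 fun γ hγ =>
      hg γ (by have := Finset.mem_range.1 hi; omega)).trans ?_
    rw [Finset.sum_add_distrib, Finset.sum_ite_eq']
    refine add_le_add le_rfl ?_
    split_ifs <;> simp [E]
  have h3 : lpNorm 1 (cube a ℓ) (u - polyFun a P)
      ≤ lpNorm 1 (cube a ℓ) (u - polyFun a P - fun x => k + linForm a l x) + E := by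
    refine (ENNReal.add_le_add_iff_left hStop).1 (h.trans ?_)
    rw [add_left_comm, add_comm]
    exact add_le_add le_rfl h2
  have hE : E = ENNReal.ofReal
      ((Finset.piAntidiag (Finset.univ : Finset (Fin N)) 1).card * (K * ℓ ^ N)) := by
    rw [ENNReal.ofReal_mul (by positivity), ENNReal.ofReal_natCast]
  rw [InLp.lpNorm_eq (hum.sub hPm), InLp.lpNorm_eq ((hum.sub hPm).sub hqm), hE,
    ← ENNReal.ofReal_add (rnorm_nonneg _ _ _) (by positivity)] at h3
  exact (ENNReal.ofReal_le_ofReal_iff (add_nonneg (rnorm_nonneg _ _ _) (by positivity))).1 h3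

/-- On large cubes the best approximation of a nonnegative function in `W^{r,1}` is not close to a
linear form. -/
lemma side_le_of_minimal {r : ℕ} (hr : 1 ≤ r) {a l : Fin N → ℝ} {ℓ δ : ℝ} (hℓ : 0 < ℓ)
    {i : Fin N} (hi : l i ≠ 0) (hmax : ∀ j, |l j| ≤ |l i|) {u : (Fin N → ℝ) → ℝ}
    (hu : u ∈ sobolev (r + 1) 1 (cube a ℓ))
    (hu0 : ∀ᵐ x ∂(volume.restrict (cube a ℓ)), 0 ≤ u x)
    {P : MvPolynomial (Fin N) ℝ} (hP : P.totalDegree ≤ r)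
    (hmin : ∀ R : MvPolynomial (Fin N) ℝ, R.totalDegree ≤ r →
      approxError r 1 a ℓ u P ≤ approxError r 1 a ℓ u R)
    (hδ0 : 0 ≤ δ) (hδ : 224 * N * δ ≤ 1)
    (h1 : rnorm 1 (cube a ℓ) (polyFun a P - linForm a l)
      ≤ 2 * δ * rnorm 1 (cube a ℓ) (linForm a l))
    (h2 : rnorm 1 (cube a ℓ) (u - fun x => max (linForm a l x) 0)
      ≤ 3 * δ * rnorm 1 (cube a ℓ) (linForm a l)) :
    ℓ ≤ 32 * (Finset.piAntidiag (Finset.univ : Finset (Fin N)) 1).card := by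
  have hs := continuous_linForm a l
  have hum : InLp 1 (cube a ℓ) u := hu.1
  have hPm : InLp 1 (cube a ℓ) (polyFun a P) := memLp_cube 1 a ℓ (contDiff_polyFun a P).continuous
  have hsm : InLp 1 (cube a ℓ) (linForm a l) := memLp_cube 1 a ℓ hs
  have hpos : InLp 1 (cube a ℓ) fun x => max (linForm a l x) 0 := memLp_cube 1 a ℓ (by fun_prop)
  have habs : InLp 1 (cube a ℓ) fun x => |linForm a l x| / 2 - |l i| * ℓ / 16 :=
    memLp_cube 1 a ℓ (by fun_prop)
  have hl : ∀ j, |(fun j => -(l j / 2)) j| ≤ |l i| / 2 := fun j => by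
    simp only [abs_neg, abs_div, Nat.abs_ofNat]
    linarith [hmax j]
  -- The perturbation is k - s/2 with k = |l i|ℓ/16. As u - P is close to s⁺ - s and s⁺ - s/2 =
  -- |s|/2, the new error is close to |s|/2 - k.
  have hmn := rnorm_le_of_minimal hr hℓ (|l i| * ℓ / 16) hl (by positivity) hu hP hmin
  have hlow := rnorm_linForm_le_of_nonneg (l := l) le_rfl hum hu0
  rw [div_one, Real.rpow_neg_one] at hlow
  have t1 : rnorm 1 (cube a ℓ) (u - linForm a l)
      ≤ rnorm 1 (cube a ℓ) (u - polyFun a P) + rnorm 1 (cube a ℓ) (polyFun a P - linForm a l) := by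
    have := rnorm_add_le le_rfl (hum.sub hPm) (hPm.sub hsm)
    rwa [sub_add_sub_cancel] at this
  have t2 : rnorm 1 (cube a ℓ)
        (u - polyFun a P - fun x => |l i| * ℓ / 16 + linForm a (fun j => -(l j / 2)) x)
      ≤ rnorm 1 (cube a ℓ) (u - fun x => max (linForm a l x) 0)
        + rnorm 1 (cube a ℓ) (fun x => |linForm a l x| / 2 - |l i| * ℓ / 16)
        + rnorm 1 (cube a ℓ) (polyFun a P - linForm a l) := by
    have hsp : rnorm 1 (cube a ℓ) (linForm a l - polyFun a P)
        = rnorm 1 (cube a ℓ) (polyFun a P - linForm a l) := by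
      unfold rnorm lpNorm
      rw [← eLpNorm_neg, neg_sub]
    have e : (u - polyFun a P - fun x => |l i| * ℓ / 16 + linForm a (fun j => -(l j / 2)) x)
        = ((u - fun x => max (linForm a l x) 0)
          + fun x => |linForm a l x| / 2 - |l i| * ℓ / 16) + (linForm a l - polyFun a P) := by
      ext x
      have h3 : linForm a (fun j => -(l j / 2)) x = -(linForm a l x / 2) := by
        simp only [linForm, Finset.sum_div, ← Finset.sum_neg_distrib]
        exact Finset.sum_congr rfl fun j _ => by ring
      simp only [Pi.sub_apply, Pi.add_apply, h3]
      rcases le_total 0 (linForm a l x) with h | h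
      · rw [max_eq_left h, abs_of_nonneg h]; ring
      · rw [max_eq_right h, abs_of_nonpos h]; ring
    rw [e, ← hsp]
    refine (rnorm_add_le le_rfl ((hum.sub hpos).add habs) (hsm.sub hPm)).trans ?_
    exact add_le_add (rnorm_add_le le_rfl (hum.sub hpos) habs) le_rfl
  have hgap := integral_abs_half_sub_le (a := a) hℓ hi
  rw [← rnorm_one habs] at hgap
  have hup := rnorm_one_le_of_bound hℓ hsm fun x hx => abs_linForm_le hmax hx
  have hli : 0 < |l i| := abs_pos.2 hi
  set n := rnorm 1 (cube a ℓ) (linForm a l)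
  set κ : ℝ := ((Finset.piAntidiag (Finset.univ : Finset (Fin N)) 1).card : ℝ)
  -- Here 7 = 2 + 3 + 2: P is replaced by s twice, at cost 2δn each, and u by s⁺ once, at cost 3δn.
  -- The condition on 224Nδ lets these absorb at most half of the gain.
  have h3 : |l i| * ℓ / 32 * ℓ ^ N ≤ 7 * δ * n + κ * (|l i| / 2 * ℓ ^ N) := by linarith
  have h4 : 7 * δ * n ≤ 1 / 64 * (|l i| * ℓ) * ℓ ^ N := by
    calc 7 * δ * n ≤ 7 * δ * (N * (|l i| * (ℓ / 2)) * ℓ ^ N) := by gcongr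
      _ = (224 * N * δ) * (1 / 64 * (|l i| * ℓ) * ℓ ^ N) := by ring
      _ ≤ 1 * (1 / 64 * (|l i| * ℓ) * ℓ ^ N) := by gcongr
      _ = _ := one_mul _
  have h5 : (|l i| * ℓ ^ N) * ℓ ≤ (|l i| * ℓ ^ N) * (32 * κ) := by linarith
  exact le_of_mul_le_mul_left h5 (by positivity)

/-! ### Product test functions adapted to the cube. -/

lemma iterate_deriv_compactSupport {f : ℝ → ℝ} (hf : HasCompactSupport f) (k : ℕ) :
    HasCompactSupport (deriv^[k] f) := by
  induction k with
  | zero => exact hf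
  | succ k ih => rw [Function.iterate_succ_apply']; exact ih.deriv

/-- A smooth function of one variable, supported near the origin, whose derivative of order `m`
vanishes around the origin and has prescribed moments on the two half lines. -/
lemma exists_profile {m : ℕ} (hm : 2 ≤ m) :
    ∃ f : ℝ → ℝ, ContDiff ℝ ∞ f ∧ HasCompactSupport f ∧ (∀ t, 1 / 4 < |t| → f t = 0) ∧
      (∀ t, |t| < 1 / 8 → deriv^[m] f t = 0) ∧ ∃ A : ℝ, 0 < A ∧
      ∫ t in Set.Ioi 0, deriv^[m] f t = 0 ∧ ∫ t in Set.Iic 0, deriv^[m] f t = 0 ∧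
      ∫ t in Set.Ioi 0, t * deriv^[m] f t = A ∧ ∫ t in Set.Iic 0, t * deriv^[m] f t = -A := by
  obtain ⟨k, rfl⟩ := Nat.exists_eq_add_of_le' hm
  let χ : ContDiffBump (0 : ℝ) := ⟨1 / 8, 1 / 4, by norm_num, by norm_num⟩
  -- With k = m - 2, the k-th derivative g of f equals k! near 0. So g'' = f^(m) vanishes there,
  -- while its first moments on the half lines do not.
  let f : ℝ → ℝ := fun t => t ^ k * χ t
  have hf : ContDiff ℝ ∞ f := (contDiff_id.pow k).mul χ.contDiff
  have hc : HasCompactSupport f := χ.hasCompactSupport.mul_left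
  set g := deriv^[k] f with hgdef
  have hg : ContDiff ℝ ∞ g := hf.iterate_deriv k
  have hgc : HasCompactSupport g := iterate_deriv_compactSupport hc k
  have hg' : ContDiff ℝ ∞ (deriv g) := hg.iterate_deriv 1
  have hh : deriv^[k + 2] f = deriv (deriv g) := by
    rw [Function.iterate_succ_apply', Function.iterate_succ_apply']
  have hg1 : ∀ t, |t| < 1 / 8 → g t = k.factorial := by
    intro t ht
    have he : f =ᶠ[nhds t] fun t => t ^ k := by
      have : Metric.ball (0 : ℝ) (1 / 8) ∈ nhds t :=
        Metric.isOpen_ball.mem_nhds (by simpa using ht)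
      filter_upwards [this] with y hy
      have : χ y = 1 := χ.one_of_mem_closedBall (Metric.ball_subset_closedBall hy)
      simp [f, this]
    rw [hgdef, ← iteratedDeriv_eq_iterate, he.iteratedDeriv_eq, iteratedDeriv_pow]
    simp [Nat.descFactorial_self]
  have hev : ∀ t, |t| < 1 / 8 → g =ᶠ[nhds t] fun _ => (k.factorial : ℝ) := by
    intro t ht
    have : Metric.ball (0 : ℝ) (1 / 8) ∈ nhds t :=
      Metric.isOpen_ball.mem_nhds (by simpa using ht)
    filter_upwards [this] with y hy
    exact hg1 y (by simpa using hy)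
  have hd1 : ∀ t, |t| < 1 / 8 → deriv g t = 0 := fun t ht => by
    rw [(hev t ht).deriv_eq, deriv_const]
  have hd2 : ∀ t, |t| < 1 / 8 → deriv (deriv g) t = 0 := fun t ht => by
    rw [(hev t ht).deriv.deriv_eq]; simp
  -- t g' - g is a compactly supported primitive of t g'', so the half-line moments reduce to its
  -- value -g(0) = -k! at the origin.
  have hd : deriv (fun t => t * deriv g t - g t) = fun t => t * deriv (deriv g) t := by
    ext t
    have h1 : HasDerivAt (deriv g) (deriv (deriv g) t) t :=
      (hg'.differentiable (by simp) t).hasDerivAt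
    have h2 : HasDerivAt g (deriv g t) t := (hg.differentiable (by simp) t).hasDerivAt
    exact (((hasDerivAt_id' t).mul h1).sub h2).deriv.trans (by ring)
  have hGc : ContDiff ℝ 1 fun t => t * deriv g t - g t :=
    ((contDiff_id.mul hg').sub hg).of_le (by exact_mod_cast le_top)
  have hGs : HasCompactSupport fun t => t * deriv g t - g t :=
    (HasCompactSupport.mul_left hgc.deriv).sub hgc
  have hg'1 : ContDiff ℝ 1 (deriv g) := hg'.of_le (by exact_mod_cast le_top)
  have h00 : |(0 : ℝ)| < 1 / 8 := by norm_num
  refine ⟨f, hf, hc, fun t ht => ?_, ?_, k.factorial, by positivity, ?_⟩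
  · have : χ t = 0 := χ.zero_of_le_dist (by simpa [χ] using ht.le)
    simp [f, this]
  · rwa [hh]
  · rw [hh, ← hd, hgc.deriv.integral_Ioi_deriv_eq hg'1, hgc.deriv.integral_Iic_deriv_eq hg'1,
      hGs.integral_Ioi_deriv_eq hGc, hGs.integral_Iic_deriv_eq hGc, hd1 0 h00, hg1 0 h00]
    simp

/-- The product test function with profile `f` in the direction `i` and `χ` in the others,
transported to the cube with centre `a` and side `ℓ`. -/
def testFn (a : Fin N → ℝ) (ℓ : ℝ) (i : Fin N) (f χ : ℝ → ℝ) : (Fin N → ℝ) → ℝ :=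
  fun x => f ((x i - a i) / ℓ) * ∏ j ∈ Finset.univ.erase i, χ ((x j - a j) / ℓ)

lemma contDiff_testFn (a : Fin N → ℝ) (ℓ : ℝ) (i : Fin N) {f χ : ℝ → ℝ} (hf : ContDiff ℝ ∞ f)
    (hχ : ContDiff ℝ ∞ χ) : ContDiff ℝ ∞ (testFn a ℓ i f χ) := by
  have h : ∀ j, ContDiff ℝ ∞ fun x : Fin N → ℝ => (x j - a j) / ℓ := fun j => by fun_prop
  exact (hf.comp (h i)).mul (contDiff_prod fun j _ => hχ.comp (h j))

lemma partialD_testFn (a : Fin N → ℝ) (ℓ : ℝ) (i : Fin N) {f χ : ℝ → ℝ} (hf : ContDiff ℝ ∞ f)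
    (hχ : ContDiff ℝ ∞ χ) :
    partialD i (testFn a ℓ i f χ) = testFn a ℓ i (fun t => ℓ⁻¹ * deriv f t) χ := by
  ext x
  rw [partialD, ← ((contDiff_testFn a ℓ i hf hχ).differentiable (by simp) x).lineDeriv_eq_fderiv,
    lineDeriv]
  have he : (fun t : ℝ => testFn a ℓ i f χ (x + t • Pi.single i 1))
      = fun t => f ((x i + t - a i) / ℓ) * ∏ j ∈ Finset.univ.erase i, χ ((x j - a j) / ℓ) := by
    ext t
    unfold testFn
    congr 1
    · simp
    · refine Finset.prod_congr rfl fun j hj => ?_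
      simp [(Finset.mem_erase.1 hj).1]
  have h1 : HasDerivAt (fun t : ℝ => (x i + t - a i) / ℓ) (1 / ℓ) 0 :=
    (((hasDerivAt_id (0 : ℝ)).const_add (x i)).sub_const (a i)).div_const ℓ
  have h2 : HasDerivAt f (deriv f ((x i - a i) / ℓ)) ((x i + 0 - a i) / ℓ) := by
    rw [add_zero]; exact (hf.differentiable (by simp) _).hasDerivAt
  rw [he]
  refine ((h2.comp (0 : ℝ) h1).mul_const _).deriv.trans ?_
  simp only [testFn]
  ring

lemma partialD_iter_testFn (a : Fin N → ℝ) (ℓ : ℝ) (i : Fin N) {f χ : ℝ → ℝ}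
    (hf : ContDiff ℝ ∞ f) (hχ : ContDiff ℝ ∞ χ) (n : ℕ) :
    (partialD i)^[n] (testFn a ℓ i f χ) = testFn a ℓ i (fun t => (ℓ ^ n)⁻¹ * deriv^[n] f t) χ := by
  induction n with
  | zero => simp
  | succ n ih =>
    have h := hf.iterate_deriv n
    rw [Function.iterate_succ_apply', ih, partialD_testFn a ℓ i (contDiff_const.mul h) hχ]
    congr 1
    ext t
    rw [deriv_const_mul _ (h.differentiable (by simp) t), Function.iterate_succ_apply', pow_succ,
      mul_inv]
    ring

lemma multiD_single (i : Fin N) (m : ℕ) (φ : (Fin N → ℝ) → ℝ) :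
    multiD (Pi.single i m) φ = (partialD i)^[m] φ := by
  -- For an arbitrary list the order is m times the multiplicity of i, which makes the induction
  -- work; `List.finRange N` contains i exactly once.
  have h : ∀ L : List (Fin N), L.foldr (fun j g => (partialD j)^[(Pi.single i m : Fin N → ℕ) j] g) φ
      = (partialD i)^[m * L.count i] φ := by
    intro L
    induction L with
    | nil => simp
    | cons j L ih =>
      rw [List.foldr_cons, ih]
      by_cases hj : j = i
      · subst hj
        rw [Pi.single_eq_same, ← Function.iterate_add_apply, List.count_cons_self, mul_add,
          mul_one, add_comm]
      · rw [Pi.single_eq_of_ne hj, List.count_cons_of_ne hj]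
        rfl
  rw [multiD, h, List.count_eq_one_of_mem (List.nodup_finRange N) (List.mem_finRange i), mul_one]

lemma testFn_eq_zero {a : Fin N → ℝ} {ℓ : ℝ} {i : Fin N} {f χ : ℝ → ℝ} {r : ℝ}
    (hf : ∀ t, r < |t| → f t = 0) (hχ : ∀ t, r < |t| → χ t = 0) {x : Fin N → ℝ} {j : Fin N}
    (hj : r < |(x j - a j) / ℓ|) : testFn a ℓ i f χ x = 0 := by
  by_cases h : j = i
  · subst h
    rw [testFn, hf _ hj, zero_mul]
  · rw [testFn, Finset.prod_eq_zero (Finset.mem_erase.2 ⟨h, Finset.mem_univ j⟩) (hχ _ hj), mul_zero]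

/-- Profiles vanishing beyond 1/4 confine the function to the concentric closed box of half side
ℓ/4, while the open cube has half side ℓ/2. -/
lemma tsupport_testFn {a : Fin N → ℝ} {ℓ : ℝ} (hℓ : 0 < ℓ) {i : Fin N} {f χ : ℝ → ℝ}
    (hf : ∀ t, 1 / 4 < |t| → f t = 0) (hχ : ∀ t, 1 / 4 < |t| → χ t = 0) :
    HasCompactSupport (testFn a ℓ i f χ) ∧ tsupport (testFn a ℓ i f χ) ⊆ cube a ℓ := by
  have h : Function.support (testFn a ℓ i f χ)
      ⊆ Set.Icc (fun j => a j - ℓ / 4) (fun j => a j + ℓ / 4) := by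
    intro x hx
    have h1 : ∀ j, |x j - a j| ≤ ℓ / 4 := fun j => by
      by_contra hj
      refine hx (testFn_eq_zero hf hχ (j := j) ?_)
      rw [abs_div, abs_of_pos hℓ, lt_div_iff₀ hℓ]
      linarith [not_le.1 hj]
    exact ⟨fun j => by have := abs_le.1 (h1 j); simp only; linarith,
      fun j => by have := abs_le.1 (h1 j); simp only; linarith⟩
  refine ⟨HasCompactSupport.of_support_subset_isCompact isCompact_Icc h, ?_⟩
  refine (closure_minimal h isClosed_Icc).trans fun x hx j => ?_
  have h1 := hx.1 j
  have h2 := hx.2 j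
  simp only at h1 h2
  rw [abs_lt]
  constructor <;> linarith

lemma abs_testFn_le {a : Fin N → ℝ} {ℓ : ℝ} {i : Fin N} {f χ : ℝ → ℝ} {C : ℝ}
    (hf : ∀ t, |f t| ≤ C) (hχ : ∀ t, |χ t| ≤ 1) (x : Fin N → ℝ) : |testFn a ℓ i f χ x| ≤ C := by
  rw [testFn, abs_mul, Finset.abs_prod]
  calc _ ≤ C * 1 := by
        refine mul_le_mul (hf _) (Finset.prod_le_one (fun _ _ => abs_nonneg _) fun j _ => hχ _)
          (Finset.prod_nonneg fun _ _ => abs_nonneg _) ((abs_nonneg _).trans (hf 0))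
    _ = C := mul_one C

/-! ### Integrals of the positive part of a linear form against the test function. -/

/-- Transport of an integral against a test function to the unit cube. -/
lemma integral_posPart_mul_testFn_scale (a l : Fin N → ℝ) {ℓ : ℝ} (hℓ : 0 < ℓ) (i : Fin N)
    (h χ : ℝ → ℝ) :
    ∫ x, max (linForm a l x) 0 * testFn a ℓ i h χ x
      = ℓ ^ (N + 1) * ∫ y, max (linForm 0 l y) 0 * testFn 0 1 i h χ y := by
  have h1 := integral_add_left_eq_self (μ := (volume : Measure (Fin N → ℝ)))
    (fun x => max (linForm a l x) 0 * testFn a ℓ i h χ x) a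
  have h2 := Measure.integral_comp_smul (volume : Measure (Fin N → ℝ))
    (fun x => max (linForm a l (a + x)) 0 * testFn a ℓ i h χ (a + x)) ℓ
  -- The homogeneity of s⁺ contributes one factor ℓ, the Jacobian the other N.
  have h3 : ∀ y : Fin N → ℝ, max (linForm a l (a + ℓ • y)) 0 * testFn a ℓ i h χ (a + ℓ • y)
      = ℓ * (max (linForm 0 l y) 0 * testFn 0 1 i h χ y) := by
    intro y
    have e1 : linForm a l (a + ℓ • y) = ℓ * linForm 0 l y := by
      simp only [linForm, Pi.add_apply, Pi.smul_apply, smul_eq_mul, Pi.zero_apply, Finset.mul_sum]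
      exact Finset.sum_congr rfl fun j _ => by ring
    have e2 : testFn a ℓ i h χ (a + ℓ • y) = testFn 0 1 i h χ y := by
      simp [testFn, hℓ.ne']
    rw [e1, e2, ← mul_assoc, mul_max_of_nonneg _ _ hℓ.le, mul_zero]
  simp only [h3] at h2
  rw [integral_const_mul, h1, Module.finrank_fin_fun, smul_eq_mul,
    abs_of_pos (by positivity)] at h2
  have hne : ℓ ^ N ≠ 0 := by positivity
  rw [eq_comm, inv_mul_eq_iff_eq_mul₀ hne] at h2
  rw [h2, pow_succ]
  ring

/-- The integral of the positive part of a linear form against a suitable product function. -/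
lemma integral_posPart_mul_testFn (l : Fin N → ℝ) {i : Fin N} (hi : l i ≠ 0)
    (hmax : ∀ j, |l j| ≤ |l i|) {h χ : ℝ → ℝ} (hh : Continuous h) (hhc : HasCompactSupport h)
    (hχ : Continuous χ) (hχc : HasCompactSupport χ)
    (hh0 : ∀ t, |t| < 1 / 8 → h t = 0) (hχ0 : ∀ t, 1 / (8 * (N : ℝ)) < |t| → χ t = 0)
    {A : ℝ} (i1 : ∫ t in Set.Ioi 0, h t = 0) (i2 : ∫ t in Set.Iic 0, h t = 0)
    (i3 : ∫ t in Set.Ioi 0, t * h t = A) (i4 : ∫ t in Set.Iic 0, t * h t = -A) :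
    ∫ y, max (linForm 0 l y) 0 * testFn 0 1 i h χ y = |l i| * A * (∫ t, χ t) ^ (N - 1) := by
  -- `H` is the half line on which `l i * t` is nonnegative. Where the test function does not
  -- vanish, `l i * y i` dominates the other terms, so s⁺ equals s times the indicator of y i ∈ `H`.
  obtain ⟨H, hH, hHin, hHout, j1, j2⟩ : ∃ H : Set ℝ, MeasurableSet H ∧ (∀ t ∈ H, 0 ≤ l i * t) ∧
      (∀ t ∉ H, l i * t ≤ 0) ∧ ∫ t in H, h t = 0 ∧ l i * ∫ t in H, t * h t = |l i| * A := by
    rcases lt_or_gt_of_ne hi with hneg | hpos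
    · refine ⟨Set.Iic 0, measurableSet_Iic, fun t ht => ?_, fun t ht => ?_, i2, ?_⟩
      · exact mul_nonneg_of_nonpos_of_nonpos hneg.le ht
      · exact mul_nonpos_of_nonpos_of_nonneg hneg.le (not_le.1 ht).le
      · rw [i4, abs_of_neg hneg]; ring
    · refine ⟨Set.Ioi 0, measurableSet_Ioi, fun t ht => ?_, fun t ht => ?_, i1, ?_⟩
      · exact mul_nonneg hpos.le (le_of_lt ht)
      · exact mul_nonpos_of_nonneg_of_nonpos hpos.le (not_lt.1 ht)
      · rw [i3, abs_of_pos hpos]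
  -- `G k j` is the j-th factor of the product attached to the term `l k * y k` of the form; the sum
  -- over k is then integrated by Fubini.
  let G : Fin N → Fin N → ℝ → ℝ := fun k j t =>
    (if j = k then t else 1) * (if j = i then H.indicator h t else χ t)
  have hN : (0 : ℝ) < N := by
    have : 0 < N := i.pos
    exact_mod_cast this
  have hpt : ∀ y : Fin N → ℝ, max (linForm 0 l y) 0 * testFn 0 1 i h χ y
      = ∑ k, l k * ∏ j, G k j (y j) := by
    intro y
    have e1 : ∀ k, ∏ j, G k j (y j)
        = y k * (H.indicator h (y i) * ∏ j ∈ Finset.univ.erase i, χ (y j)) := by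
      intro k
      rw [Finset.prod_mul_distrib]
      congr 1
      · simp
      · rw [← Finset.mul_prod_erase _ _ (Finset.mem_univ i), if_pos rfl]
        congr 1
        exact Finset.prod_congr rfl fun j hj => by rw [if_neg (Finset.mem_erase.1 hj).1]
    have e2 : ∑ k, l k * ∏ j, G k j (y j)
        = linForm 0 l y * (H.indicator h (y i) * ∏ j ∈ Finset.univ.erase i, χ (y j)) := by
      simp only [e1, linForm, Finset.sum_mul, Pi.zero_apply, sub_zero]
      exact Finset.sum_congr rfl fun k _ => by ring
    rw [e2]
    simp only [testFn, Pi.zero_apply, sub_zero, div_one]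
    by_cases hw : ∏ j ∈ Finset.univ.erase i, χ (y j) = 0
    · simp [hw]
    by_cases hyi : |y i| < 1 / 8
    · simp [hh0 _ hyi]
    have hyj : ∀ j ∈ Finset.univ.erase i, |y j| ≤ 1 / (8 * (N : ℝ)) := fun j hj => by
      by_contra hlt
      exact hw (Finset.prod_eq_zero hj (hχ0 _ (not_le.1 hlt)))
    -- Fewer than N remaining terms, each at most |l i|/(8N), against |y i| ≥ 1/8.
    have hτ : |linForm 0 l y - l i * y i| ≤ |l i * y i| := by
      have e3 : linForm 0 l y - l i * y i = ∑ j ∈ Finset.univ.erase i, l j * y j := by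
        simp only [linForm, Pi.zero_apply, sub_zero]
        rw [← Finset.add_sum_erase _ _ (Finset.mem_univ i)]
        ring
      rw [e3]
      refine (Finset.abs_sum_le_sum_abs _ _).trans ?_
      have : ∀ j ∈ Finset.univ.erase i, |l j * y j| ≤ |l i| * (1 / (8 * (N : ℝ))) := fun j hj => by
        rw [abs_mul]
        exact mul_le_mul (hmax j) (hyj j hj) (abs_nonneg _) (abs_nonneg _)
      refine (Finset.sum_le_card_nsmul _ _ _ this).trans ?_
      have hcard : ((Finset.univ.erase i).card : ℝ) ≤ N := by
        have := Finset.card_le_card (Finset.erase_subset i Finset.univ)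
        rw [Finset.card_univ, Fintype.card_fin] at this
        exact_mod_cast this
      rw [nsmul_eq_mul, abs_mul]
      calc ((Finset.univ.erase i).card : ℝ) * (|l i| * (1 / (8 * (N : ℝ))))
          ≤ N * (|l i| * (1 / (8 * (N : ℝ)))) := by gcongr
        _ = |l i| * (1 / 8) := by field_simp
        _ ≤ |l i| * |y i| := by gcongr; exact not_lt.1 hyi
    by_cases hyH : y i ∈ H
    · have h1 := hHin _ hyH
      rw [abs_of_nonneg h1] at hτ
      rw [max_eq_left (by linarith [(abs_le.1 hτ).1]), Set.indicator_of_mem hyH]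
    · have h1 := hHout _ hyH
      rw [abs_of_nonpos h1] at hτ
      rw [max_eq_right (by linarith [(abs_le.1 hτ).2]), Set.indicator_of_notMem hyH]
      ring
  have hGi : ∀ k j, Integrable (G k j) := by
    intro k j
    have hc : Continuous fun t : ℝ => if j = k then t else (1 : ℝ) := by
      split_ifs <;> fun_prop
    by_cases hj : j = i
    · have : G k j = H.indicator fun t => (if j = k then t else 1) * h t := by
        ext t
        by_cases ht : t ∈ H <;> simp [G, hj, ht]
      rw [this]
      exact ((hc.mul hh).integrable_of_hasCompactSupport hhc.mul_left).indicator hH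
    · have : G k j = fun t => (if j = k then t else 1) * χ t := by
        ext t
        simp [G, hj]
      rw [this]
      exact (hc.mul hχ).integrable_of_hasCompactSupport hχc.mul_left
  have hint : ∀ k, Integrable fun y : Fin N → ℝ => l k * ∏ j, G k j (y j) := fun k =>
    (Integrable.fintype_prod_dep fun j => hGi k j).const_mul _
  simp only [hpt]
  rw [integral_finsetSum _ fun k _ => hint k, Finset.sum_eq_single i]
  · rw [integral_const_mul, integral_fintype_prod_volume_eq_prod,
      ← Finset.mul_prod_erase _ _ (Finset.mem_univ i)]
    have e1 : ∫ t, G i i t = ∫ t in H, t * h t := by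
      rw [← integral_indicator hH]
      congr 1
      ext t
      by_cases ht : t ∈ H <;> simp [G, ht]
    have e2 : ∏ j ∈ Finset.univ.erase i, ∫ t, G i j t = (∫ t, χ t) ^ (N - 1) := by
      rw [Finset.prod_congr rfl (g := fun _ => ∫ t, χ t), Finset.prod_const,
        Finset.card_erase_of_mem (Finset.mem_univ i), Finset.card_univ, Fintype.card_fin]
      intro j hj
      simp [G, (Finset.mem_erase.1 hj).1]
    rw [e1, e2, ← mul_assoc, j2]
  -- For k ≠ i the factor in y i is the integral of h over `H`, which is zero.
  · intro k _ hk
    rw [integral_const_mul, integral_fintype_prod_volume_eq_prod,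
      Finset.prod_eq_zero (Finset.mem_univ i), mul_zero]
    have : G k i = H.indicator h := by
      ext t
      simp [G, hk.symm]
    rw [this, integral_indicator hH, j1]
  · simp

/-! ### Lower bound for the derivatives of order m. -/

lemma gradNorm_ne_top {m k : ℕ} (hk : k ≤ m) {p : ℝ} {Ω : Set (Fin N → ℝ)} (hΩ : IsOpen Ω)
    {u : (Fin N → ℝ) → ℝ} (hu : u ∈ sobolev m p Ω) : gradNorm k p Ω u ≠ ⊤ := by
  refine ENNReal.sum_ne_top.2 fun γ hγ => ?_
  have h1 : ∑ j, γ j = k := (Finset.mem_piAntidiag.1 hγ).1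
  obtain ⟨v, hv, hvm⟩ := hu.2 γ (by omega)
  rw [lpNorm, eLpNorm_congr_ae (hv.weakDeriv_ae_eq hΩ)]
  exact hvm.eLpNorm_ne_top

lemma rnorm_le_gradNorm {m : ℕ} {p : ℝ} {Ω : Set (Fin N → ℝ)} (hΩ : IsOpen Ω)
    {u v : (Fin N → ℝ) → ℝ} (hu : u ∈ sobolev m p Ω) {γ : Fin N → ℕ} (hγ : ∑ i, γ i = m)
    (hv : HasWeakDeriv Ω γ u v) : rnorm p Ω v ≤ (gradNorm m p Ω u).toReal := by
  refine ENNReal.toReal_mono (gradNorm_ne_top le_rfl hΩ hu) ?_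
  have hmem : γ ∈ Finset.piAntidiag (Finset.univ : Finset (Fin N)) m := by
    simp [Finset.mem_piAntidiag, hγ]
  have h := Finset.single_le_sum (f := fun γ => lpNorm p Ω (weakDeriv Ω γ u))
    (fun _ _ => zero_le) hmem
  have h2 : lpNorm p Ω (weakDeriv Ω γ u) = lpNorm p Ω v :=
    eLpNorm_congr_ae (hv.weakDeriv_ae_eq hΩ)
  rw [← h2]
  exact h

lemma abs_setIntegral_mul_le {Ω : Set (Fin N → ℝ)} {f g : (Fin N → ℝ) → ℝ} (hf : InLp 1 Ω f)
    {C : ℝ} (hg : ∀ x, |g x| ≤ C) : |∫ x in Ω, f x * g x| ≤ C * rnorm 1 Ω f := by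
  rw [rnorm_one hf, ← integral_const_mul]
  refine norm_integral_le_of_norm_le (f := fun x => f x * g x) (hf.integrableOn.abs.const_mul C)
    (Filter.Eventually.of_forall fun x => ?_)
  rw [Real.norm_eq_abs, abs_mul, mul_comm]
  exact mul_le_mul_of_nonneg_right (hg x) (abs_nonneg _)

/-- A function close in `L¹` to the positive part of a linear form has large derivatives of order
`m`. -/
lemma exists_gradNorm_ge {m : ℕ} (hN : 1 ≤ N) (hm : 2 ≤ m) :
    ∃ δ : ℝ, 0 < δ ∧ ∃ c : ℝ, 0 < c ∧ ∀ (a l : Fin N → ℝ) (ℓ : ℝ), 0 < ℓ → ∀ i : Fin N,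
      l i ≠ 0 → (∀ j, |l j| ≤ |l i|) → ∀ u ∈ sobolev m 1 (cube a ℓ),
      rnorm 1 (cube a ℓ) (u - fun x => max (linForm a l x) 0)
        ≤ 3 * δ * rnorm 1 (cube a ℓ) (linForm a l) →
      c * (|l i| * ℓ * ℓ ^ N) ≤ ℓ ^ m * (gradNorm m 1 (cube a ℓ) u).toReal := by
  obtain ⟨f, hf, hfc, hf4, hf8, A, hA, i1, i2, i3, i4⟩ := exists_profile hm
  have hN1 : (1 : ℝ) ≤ N := by exact_mod_cast hN
  have hN0 : (0 : ℝ) < N := by linarith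
  -- The outer radius 1/(8N) makes the i-th term of the form dominate; it is also below 1/4, which
  -- keeps the support inside the cube.
  let χ : ContDiffBump (0 : ℝ) := ⟨1 / (16 * N), 1 / (8 * N), by positivity, by
    gcongr; norm_num⟩
  have hχ0 : ∀ t, 1 / (8 * (N : ℝ)) < |t| → χ t = 0 := fun t ht =>
    χ.zero_of_le_dist (by simpa [χ] using ht.le)
  have hχ4 : ∀ t, 1 / 4 < |t| → χ t = 0 := fun t ht => by
    refine hχ0 t (lt_of_le_of_lt ?_ ht)
    rw [div_le_div_iff₀ (by positivity) (by norm_num)]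
    linarith
  have hχ1 : ∀ t, |χ t| ≤ 1 := fun t => by
    rw [abs_of_nonneg χ.nonneg]; exact χ.le_one
  have hχint : 0 < ∫ t, χ t := χ.integral_pos
  set h := deriv^[m] f with hh
  have hhc : HasCompactSupport h := iterate_deriv_compactSupport hfc m
  have hhd : ContDiff ℝ ∞ h := hf.iterate_deriv m
  obtain ⟨C₁, hC₁⟩ := hf.continuous.bounded_above_of_compact_support hfc
  obtain ⟨C₂, hC₂⟩ := hhd.continuous.bounded_above_of_compact_support hhc
  have hC₁0 : 0 ≤ C₁ := (norm_nonneg _).trans (hC₁ 0)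
  have hC₂0 : 0 ≤ C₂ := (norm_nonneg _).trans (hC₂ 0)
  set κ := A * (∫ t, χ t) ^ (N - 1) with hκ
  have hκ0 : 0 < κ := by positivity
  -- Testing s⁺ gives κ|l i|ℓ·ℓ^N. This δ, with ‖s‖ ≤ N|l i|(ℓ/2)ℓ^N, keeps the error of replacing u
  -- by s⁺ below half of it. The added 1 avoids division by zero.
  refine ⟨κ / (3 * N * (C₂ + 1)), by positivity, κ / 2 / (C₁ + 1), by positivity, ?_⟩
  intro a l ℓ hℓ i hi hmax u hu hclose
  obtain ⟨v, hv, hvm⟩ := hu.2 (Pi.single i m) (by simp)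
  have hum : InLp 1 (cube a ℓ) u := hu.1
  have hs := continuous_linForm a l
  have hsm : InLp 1 (cube a ℓ) (linForm a l) := memLp_cube 1 a ℓ hs
  have hpc : Continuous fun x => max (linForm a l x) 0 := by fun_prop
  have hpos : InLp 1 (cube a ℓ) fun x => max (linForm a l x) 0 := memLp_cube 1 a ℓ hpc
  obtain ⟨hφc, hφs⟩ := tsupport_testFn (a := a) (i := i) hℓ hf4 hχ4
  have hφ := contDiff_testFn a ℓ i hf χ.contDiff
  have hweak := hv.2.2 _ hφ hφc hφs
  have hDeq : multiD (Pi.single i m) (testFn a ℓ i f χ)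
      = fun x => (ℓ ^ m)⁻¹ * testFn a ℓ i h χ x := by
    rw [multiD_single, partialD_iter_testFn a ℓ i hf χ.contDiff]
    ext x
    simp only [testFn]
    ring
  have hh4 : ∀ t, 1 / 4 < |t| → h t = 0 := by
    intro t ht
    have he : f =ᶠ[nhds t] fun _ => 0 := by
      have : {y : ℝ | 1 / 4 < |y|} ∈ nhds t := (isOpen_lt continuous_const continuous_abs).mem_nhds ht
      filter_upwards [this] with y hy
      exact hf4 y hy
    rw [hh, ← iteratedDeriv_eq_iterate, he.iteratedDeriv_eq]
    simp
  obtain ⟨hTc, hTs⟩ := tsupport_testFn (a := a) (i := i) hℓ hh4 hχ4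
  have hT := (contDiff_testFn a ℓ i hhd (χ := χ) χ.contDiff).continuous
  have hsplit : ∫ x in cube a ℓ, u x * testFn a ℓ i h χ x
      = (∫ x in cube a ℓ, (u - fun x => max (linForm a l x) 0) x * testFn a ℓ i h χ x)
        + ∫ x in cube a ℓ, max (linForm a l x) 0 * testFn a ℓ i h χ x := by
    rw [← integral_add]
    · congr 1
      ext x
      simp only [Pi.sub_apply]
      ring
    · exact integrableOn_mul_test (isOpen_cube a ℓ)
        (InLp.integrableOn (hum.sub hpos)).locallyIntegrableOn hT hTc hTs
    · exact integrableOn_mul_test (isOpen_cube a ℓ) hpos.integrableOn.locallyIntegrableOn hT hTc hTs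
  have hmain : ∫ x in cube a ℓ, max (linForm a l x) 0 * testFn a ℓ i h χ x
      = |l i| * ℓ * ℓ ^ N * κ := by
    rw [setIntegral_eq_integral_of_forall_compl_eq_zero (fun x hx => by
        rw [image_eq_zero_of_notMem_tsupport fun h => hx (hTs h), mul_zero]),
      integral_posPart_mul_testFn_scale a l hℓ,
      integral_posPart_mul_testFn l hi hmax hhd.continuous hhc χ.continuous χ.hasCompactSupport
        hf8 hχ0 i1 i2 i3 i4, hκ, pow_succ]
    ring
  have herr := abs_setIntegral_mul_le (hum.sub hpos)
    (abs_testFn_le (a := a) (ℓ := ℓ) (i := i) hC₂ hχ1)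
  have hrhs := abs_setIntegral_mul_le hvm (abs_testFn_le (a := a) (ℓ := ℓ) (i := i) hC₁ hχ1)
  have hvg : rnorm 1 (cube a ℓ) v ≤ (gradNorm m 1 (cube a ℓ) u).toReal :=
    rnorm_le_gradNorm (isOpen_cube a ℓ) hu (by simp) hv
  have hup := rnorm_one_le_of_bound hℓ hsm fun x hx => abs_linForm_le hmax hx
  set G := (gradNorm m 1 (cube a ℓ) u).toReal with hG
  have hG0 : 0 ≤ G := ENNReal.toReal_nonneg
  have hweak' : |∫ x in cube a ℓ, u x * testFn a ℓ i h χ x|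
      = ℓ ^ m * |∫ x in cube a ℓ, v x * testFn a ℓ i f χ x| := by
    have e : ∫ x in cube a ℓ, u x * multiD (Pi.single i m) (testFn a ℓ i f χ) x
        = (ℓ ^ m)⁻¹ * ∫ x in cube a ℓ, u x * testFn a ℓ i h χ x := by
      rw [hDeq, ← integral_const_mul]
      congr 1
      ext x
      ring
    rw [e] at hweak
    have h3 := congrArg abs hweak
    rw [abs_mul, abs_mul, abs_pow, abs_neg, abs_one, one_pow, one_mul,
      abs_of_pos (by positivity : 0 < (ℓ ^ m)⁻¹), inv_mul_eq_iff_eq_mul₀ (by positivity)] at h3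
    exact h3
  set M := |l i| * ℓ * ℓ ^ N with hM
  have hM0 : 0 < M := by have := abs_pos.2 hi; positivity
  have e1 : C₂ * rnorm 1 (cube a ℓ) (u - fun x => max (linForm a l x) 0) ≤ M * κ / 2 := by
    calc _ ≤ (C₂ + 1) * (3 * (κ / (3 * N * (C₂ + 1))) * (N * (|l i| * (ℓ / 2)) * ℓ ^ N)) := by
          refine mul_le_mul (by linarith) (hclose.trans ?_) (rnorm_nonneg _ _ _) (by positivity)
          gcongr
      _ = M * κ / 2 := by
          rw [hM]
          field_simp
  have e2 : M * κ / 2 ≤ ℓ ^ m * ((C₁ + 1) * G) := by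
    have h1 : M * κ / 2 ≤ |∫ x in cube a ℓ, u x * testFn a ℓ i h χ x| := by
      rw [hsplit, hmain]
      refine le_trans ?_ (le_abs_self _)
      linarith [(abs_le.1 herr).1]
    refine h1.trans ?_
    rw [hweak']
    gcongr
    refine hrhs.trans ?_
    exact mul_le_mul (by linarith) hvg (rnorm_nonneg _ _ _) (by linarith)
  rw [div_mul_eq_mul_div, div_le_iff₀ (by positivity)]
  linarith

/-! ### The dichotomy: dominant constant part or large derivatives. -/

/-- Either the constant part of the best approximation of a nonnegative function controls the
linear part, or the derivatives of order `m` are large. -/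
lemma exists_const_or_gradNorm_ge {m : ℕ} (hN : 1 ≤ N) (hm : 2 ≤ m) {p : ℝ} (hp : 1 ≤ p) :
    ∃ δ : ℝ, 0 < δ ∧ δ ≤ 1 ∧ ∃ c : ℝ, 0 < c ∧ ∀ (a : Fin N → ℝ) (ℓ : ℝ), 0 < ℓ →
      ∀ u ∈ sobolevNonneg m p (cube a ℓ), ∀ P : MvPolynomial (Fin N) ℝ, P.totalDegree ≤ m - 1 →
      (∀ R : MvPolynomial (Fin N) ℝ, R.totalDegree ≤ m - 1 →
        approxError (m - 1) p a ℓ u P ≤ approxError (m - 1) p a ℓ u R) →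
      ∀ α : ℝ, 2 / δ ≤ α →
      α * rnorm p (cube a ℓ) (polyFun a (P - lowPart 1 P))
        ≤ rnorm p (cube a ℓ) (polyFun a (lowPart 1 P)) →
      rnorm p (cube a ℓ) (u - polyFun a P) ≤ 2⁻¹ * rnorm p (cube a ℓ) (polyFun a P) →
      δ * rnorm p (cube a ℓ) (linForm a fun i => P.coeff (Finsupp.single i 1))
          ≤ rnorm p (cube a ℓ) (polyFun a (lowPart 0 P)) ∨
        c * rnorm p (cube a ℓ) (polyFun a (lowPart 1 P)) ≤ (gradNorm m p (cube a ℓ) u).toReal := by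
  rcases eq_or_lt_of_le hp with rfl | hp1
  · obtain ⟨δ₁, hδ₁, c, hc, H⟩ := exists_gradNorm_ge hN hm
    have hN1 : (1 : ℝ) ≤ N := by exact_mod_cast hN
    set κ : ℝ := ((Finset.piAntidiag (Finset.univ : Finset (Fin N)) 1).card : ℝ)
    have hδ0 : 0 < min δ₁ (1 / (224 * N)) := lt_min hδ₁ (by positivity)
    have hδ1 : min δ₁ (1 / (224 * (N : ℝ))) ≤ 1 := by
      refine (min_le_right _ _).trans ?_
      rw [div_le_one (by positivity)]
      linarith
    -- The cap 1/(224N) serves the bound ℓ ≤ 32κ on the side, and `δ₁` the lower bound for ∇^m u; in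
    -- the constant, (32κ)^m pays for the factor ℓ^m.
    refine ⟨min δ₁ (1 / (224 * N)), hδ0, hδ1, c / (N * ((32 * κ) ^ m + 1)), by positivity, ?_⟩
    intro a ℓ hℓ u hu P hPd hmin α hα h1 h2
    set δ := min δ₁ (1 / (224 * (N : ℝ))) with hδ
    set l : Fin N → ℝ := fun i => P.coeff (Finsupp.single i 1)
    refine or_iff_not_imp_left.2 fun hcon => ?_
    rw [not_le] at hcon
    have hum : InLp 1 (cube a ℓ) u := hu.1.1
    have hPm : InLp 1 (cube a ℓ) (polyFun a P) :=
      memLp_cube 1 a ℓ (contDiff_polyFun a P).continuous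
    have hsm : InLp 1 (cube a ℓ) (linForm a l) := memLp_cube 1 a ℓ (continuous_linForm a l)
    have hbm : InLp 1 (cube a ℓ) (fun _ => P.coeff 0) := memLp_cube 1 a ℓ continuous_const
    rw [polyFun_lowPart_zero] at hcon
    rw [polyFun_sub, polyFun_lowPart_one] at h1
    obtain ⟨k1, k2⟩ := rnorm_sub_le_of_small_const le_rfl hum hPm hbm hsm hδ0 hδ1 hα h1 h2 hcon.le
    have k3 : rnorm 1 (cube a ℓ) (u - fun x => max (linForm a l x) 0)
        ≤ 3 * δ * rnorm 1 (cube a ℓ) (linForm a l) := by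
      rw [rnorm_one_sub_posPart hum hu.2]
      linarith
    have : Nonempty (Fin N) := ⟨⟨0, hN⟩⟩
    obtain ⟨i, -, hmax⟩ := Finset.exists_max_image Finset.univ (fun j => |l j|)
      Finset.univ_nonempty
    have hmax' : ∀ j, |l j| ≤ |l i| := fun j => hmax j (Finset.mem_univ j)
    have hup := rnorm_one_le_of_bound hℓ hsm fun x hx => abs_linForm_le hmax' hx
    -- If the largest coefficient were zero, then s = 0, and ‖b‖ < δ‖s‖ would be impossible.
    have hi : l i ≠ 0 := by
      intro hi
      rw [hi] at hup
      simp only [abs_zero, zero_mul, mul_zero] at hup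
      have hn : rnorm 1 (cube a ℓ) (linForm a l) = 0 := le_antisymm hup (rnorm_nonneg _ _ _)
      rw [hn, mul_zero] at hcon
      exact absurd hcon (not_lt.2 (rnorm_nonneg _ _ _))
    have hr : m - 1 + 1 = m := by omega
    have hside : ℓ ≤ 32 * κ := by
      refine side_le_of_minimal (r := m - 1) (by omega) hℓ hi hmax' (by rw [hr]; exact hu.1) hu.2
        hPd hmin hδ0.le ?_ k1 k3
      have : δ ≤ 1 / (224 * N) := min_le_right _ _
      rwa [le_div_iff₀ (by positivity), mul_comm] at this
    have hgr := H a l ℓ hℓ i hi hmax' u hu.1 (k3.trans (by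
      have := rnorm_nonneg 1 (cube a ℓ) (linForm a l)
      gcongr
      exact min_le_left _ _))
    set G := (gradNorm m 1 (cube a ℓ) u).toReal
    have hG0 : 0 ≤ G := ENNReal.toReal_nonneg
    have hlow : rnorm 1 (cube a ℓ) (polyFun a (lowPart 1 P)) ≤ N * (|l i| * ℓ * ℓ ^ N) := by
      rw [polyFun_lowPart_one]
      refine (rnorm_add_le le_rfl hbm hsm).trans ?_
      have h3 : δ * rnorm 1 (cube a ℓ) (linForm a l) ≤ 1 * rnorm 1 (cube a ℓ) (linForm a l) :=
        mul_le_mul_of_nonneg_right hδ1 (rnorm_nonneg _ _ _)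
      linarith
    rw [div_mul_eq_mul_div, div_le_iff₀ (by positivity)]
    calc c * rnorm 1 (cube a ℓ) (polyFun a (lowPart 1 P))
        ≤ c * (N * (|l i| * ℓ * ℓ ^ N)) := by gcongr
      _ = N * (c * (|l i| * ℓ * ℓ ^ N)) := by ring
      _ ≤ N * (ℓ ^ m * G) := by gcongr
      _ ≤ N * (((32 * κ) ^ m + 1) * G) := by
          gcongr
          exact (pow_le_pow_left₀ hℓ.le hside m).trans (by linarith)
      _ = G * (N * ((32 * κ) ^ m + 1)) := by ring
  · have hp0 : 0 < p := by linarith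
    have hlt : (1 / 2 : ℝ) < 2 ^ (-(1 / p)) := by
      have : (2 : ℝ) ^ (-1 : ℝ) < 2 ^ (-(1 / p)) := by
        refine Real.rpow_lt_rpow_of_exponent_lt (by norm_num) ?_
        rw [neg_lt_neg_iff, div_lt_one hp0]
        exact hp1
      rwa [Real.rpow_neg_one, ← one_div] at this
    have hle : (2 : ℝ) ^ (-(1 / p)) ≤ 1 :=
      Real.rpow_le_one_of_one_le_of_nonpos (by norm_num) (by
        rw [neg_nonpos]; positivity)
    -- One sixth of the gap puts 1/2 + 3δ halfway between 1/2 and 2^(-1/p). The first alternative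
    -- then always holds, so the constant 1 of the second is arbitrary.
    refine ⟨(2 ^ (-(1 / p)) - 1 / 2) / 6, by linarith, by linarith, 1, one_pos, ?_⟩
    intro a ℓ hℓ u hu P hPd hmin α hα h1 h2
    left
    set l : Fin N → ℝ := fun i => P.coeff (Finsupp.single i 1)
    by_contra hcon
    rw [not_le, polyFun_lowPart_zero] at hcon
    rw [polyFun_sub, polyFun_lowPart_one] at h1
    have hum : InLp p (cube a ℓ) u := hu.1.1
    have hPm : InLp p (cube a ℓ) (polyFun a P) :=
      memLp_cube p a ℓ (contDiff_polyFun a P).continuous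
    have hsm : InLp p (cube a ℓ) (linForm a l) := memLp_cube p a ℓ (continuous_linForm a l)
    have hbm : InLp p (cube a ℓ) (fun _ => P.coeff 0) := memLp_cube p a ℓ continuous_const
    obtain ⟨-, k2⟩ := rnorm_sub_le_of_small_const hp hum hPm hbm hsm (by linarith) (by linarith)
      hα h1 h2 hcon.le
    have k3 := (rnorm_linForm_le_of_nonneg (l := l) hp hum hu.2).trans k2
    have hn : 0 < rnorm p (cube a ℓ) (linForm a l) := by
      refine lt_of_le_of_ne (rnorm_nonneg _ _ _) fun h0 => ?_
      rw [← h0, mul_zero] at hcon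
      exact absurd hcon (not_lt.2 (rnorm_nonneg _ _ _))
    have := le_of_mul_le_mul_right k3 hn
    linarith

end

end PolyCap

/-! ### Comparison of the two capacities. -/

open PolyCap in
theorem theorem2p27 (N m : ℕ) (hN : 1 ≤ N) (hm : 2 ≤ m) (p : ℝ) (hp : 1 ≤ p) :
    ∃ α₀ : ℝ, 0 < α₀ ∧ ∀ α : ℝ, α₀ ≤ α →
      ∃ α' : ℝ, 0 < α' ∧ ∃ c : ℝ, 0 < c ∧
        ∀ (a : Fin N → ℝ) (ℓ : ℝ), 0 < ℓ →
        ∀ Pr : ((Fin N → ℝ) → ℝ) → MvPolynomial (Fin N) ℝ,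
          PolyCap.IsProjection (m - 1) p a ℓ Pr →
        ∀ A : Set ((Fin N → ℝ) → ℝ), A ⊆ PolyCap.sobolevNonneg m p (PolyCap.cube a ℓ) →
          ENNReal.ofReal c * PolyCap.Theta m 0 p a ℓ Pr α' A
            ≤ PolyCap.Theta m 1 p a ℓ Pr α A := by
  obtain ⟨δ, hδ0, hδ1, c₁, hc₁, H⟩ := exists_const_or_gradNorm_ge hN hm hp
  have hp0 : 0 < p := by linarith
  have hδ2 : 2 ≤ 2 / δ := by rw [le_div_iff₀ hδ0]; linarith
  have hK1 : 1 ≤ (1 + 1 / δ) ^ p := Real.one_le_rpow (by simpa using hδ0.le) hp0.le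
  -- When δ‖s‖ ≤ ‖b‖, one has ‖b + s‖ ≤ (1 + 1/δ)‖b‖, and since ‖R‖ ≤ ‖b + s‖, also ‖R‖ + ‖s‖ ≤ (1 +
  -- 2/δ)‖b‖. These give the first entry of the minimum and α'. The second entry serves the case of
  -- large derivatives.
  refine ⟨2 / δ, by positivity, fun α hα => ⟨(1 + 2 / δ)⁻¹, by positivity,
    min ((1 + 1 / δ) ^ p)⁻¹ (c₁ ^ p), by positivity, ?_⟩⟩
  intro a ℓ hℓ Pr hPr A hA
  set c := min ((1 + 1 / δ) ^ p)⁻¹ (c₁ ^ p)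
  have hc1 : ENNReal.ofReal c ≤ 1 := by
    rw [ENNReal.ofReal_le_one]
    exact (min_le_left _ _).trans (inv_le_one_of_one_le₀ hK1)
  have hΘ1 : Theta m 0 p a ℓ Pr (1 + 2 / δ)⁻¹ A ≤ 1 := min_le_right _ _
  -- The truncation at 1 costs nothing, since c ≤ 1 and the capacity for k = 0 is at most 1.
  refine le_min (le_iInf₂ fun u hu => ?_) (mul_le_one' hc1 hΘ1)
  obtain ⟨⟨huA, h1, h2⟩, h3⟩ := hu
  have huS := hA huA
  have hr : m - 1 + 1 = m := by omega
  obtain ⟨hdeg, hmin⟩ := hPr u (by rw [hr]; exact huS.1)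
  set P := Pr u with hP
  set Q := cube a ℓ with hQ
  have hpoly : ∀ R, InLp p Q (polyFun a R) := fun R =>
    memLp_cube p a ℓ (contDiff_polyFun a R).continuous
  have hGtop := gradNorm_ne_top le_rfl (isOpen_cube a ℓ) huS.1
  have hα0 : 0 ≤ α := by linarith
  have r1 : α * rnorm p Q (polyFun a (P - lowPart 1 P)) ≤ rnorm p Q (polyFun a (lowPart 1 P)) := by
    rw [(hpoly _).lpNorm_eq, (hpoly (lowPart 1 P)).lpNorm_eq, ← ENNReal.ofReal_mul hα0] at h1
    exact (ENNReal.ofReal_le_ofReal_iff (rnorm_nonneg _ _ _)).1 h1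
  have r2 : rnorm p Q (u - polyFun a P) ≤ 2⁻¹ * rnorm p Q (polyFun a P) := by
    have := ENNReal.toReal_mono (ENNReal.mul_ne_top (by simp) (hpoly P).lpNorm_ne_top) h2
    rwa [ENNReal.toReal_mul, ENNReal.toReal_inv, ENNReal.toReal_ofNat] at this
  have hn1 : 0 < rnorm p Q (polyFun a (lowPart 1 P)) :=
    ENNReal.toReal_pos h3 (hpoly _).lpNorm_ne_top
  rcases H a ℓ hℓ u huS P hdeg hmin α hα r1 r2 with h | h
  · set s := linForm a fun i => P.coeff (Finsupp.single i 1)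
    have hsm : InLp p Q s := memLp_cube p a ℓ (continuous_linForm _ _)
    have hsum : polyFun a (lowPart 1 P) = polyFun a (lowPart 0 P) + s := by
      rw [polyFun_lowPart_one, polyFun_lowPart_zero]
    have t1 : rnorm p Q (polyFun a (lowPart 1 P)) ≤ rnorm p Q (polyFun a (lowPart 0 P))
        + rnorm p Q s := by
      rw [hsum]; exact rnorm_add_le hp (hpoly _) hsm
    have t2 : rnorm p Q s ≤ 1 / δ * rnorm p Q (polyFun a (lowPart 0 P)) := by
      rw [div_mul_eq_mul_div, one_mul, le_div_iff₀ hδ0]; linarith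
    have t3 : rnorm p Q (polyFun a (lowPart 1 P))
        ≤ (1 + 1 / δ) * rnorm p Q (polyFun a (lowPart 0 P)) := by linarith
    have t4 : rnorm p Q (polyFun a (P - lowPart 0 P))
        ≤ rnorm p Q (polyFun a (P - lowPart 1 P)) + rnorm p Q s := by
      have := rnorm_add_le hp (hpoly (P - lowPart 1 P)) hsm
      rwa [polyFun_sub, hsum, show polyFun a P - (polyFun a (lowPart 0 P) + s) + s
        = polyFun a P - polyFun a (lowPart 0 P) by abel, ← hsum, ← polyFun_sub, ← polyFun_sub]
        at this
    have t5 : rnorm p Q (polyFun a (P - lowPart 1 P)) ≤ rnorm p Q (polyFun a (lowPart 1 P)) := by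
      refine le_trans ?_ r1
      exact le_mul_of_one_le_left (rnorm_nonneg _ _ _) (by linarith)
    have t6 : rnorm p Q (polyFun a (P - lowPart 0 P))
        ≤ (1 + 2 / δ) * rnorm p Q (polyFun a (lowPart 0 P)) := by
      have : 2 / δ = 1 / δ + 1 / δ := by ring
      rw [this]
      linarith
    have hn0 : 0 < rnorm p Q (polyFun a (lowPart 0 P)) := by
      by_contra hcon
      have h0 : rnorm p Q (polyFun a (lowPart 0 P)) = 0 :=
        le_antisymm (not_lt.1 hcon) (rnorm_nonneg _ _ _)
      rw [h0, mul_zero] at t3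
      linarith
    have hmem : u ∈ {u ∈ testClass 0 p a ℓ Pr (1 + 2 / δ)⁻¹ A |
        lpNorm p (cube a ℓ) (polyFun a (lowPart 0 (Pr u))) ≠ 0} := by
      refine ⟨⟨huA, ?_, h2⟩, ?_⟩
      · rw [← hP, ← hQ, (hpoly _).lpNorm_eq, (hpoly (lowPart 0 P)).lpNorm_eq,
          ← ENNReal.ofReal_mul (by positivity)]
        refine ENNReal.ofReal_le_ofReal ?_
        rwa [inv_mul_le_iff₀ (by positivity)]
      · rw [← hP, ← hQ, (hpoly _).lpNorm_eq]
        simpa using hn0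
    have hΘ : Theta m 0 p a ℓ Pr (1 + 2 / δ)⁻¹ A
        ≤ gradNorm m p Q u ^ p / lpNorm p Q (polyFun a (lowPart 0 P)) ^ p :=
      (min_le_left _ _).trans (iInf₂_le u hmem)
    refine (mul_le_mul' (ENNReal.ofReal_le_ofReal (min_le_left _ _)) hΘ).trans ?_
    rw [← ENNReal.ofReal_toReal hGtop, (hpoly _).lpNorm_eq, (hpoly (lowPart 1 P)).lpNorm_eq,
      ENNReal.ofReal_rpow_of_nonneg ENNReal.toReal_nonneg hp0.le,
      ENNReal.ofReal_rpow_of_pos hn0, ENNReal.ofReal_rpow_of_pos hn1,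
      ← ENNReal.ofReal_div_of_pos (Real.rpow_pos_of_pos hn0 p),
      ← ENNReal.ofReal_div_of_pos (Real.rpow_pos_of_pos hn1 p),
      ← ENNReal.ofReal_mul (by positivity)]
    refine ENNReal.ofReal_le_ofReal ?_
    have hpow := Real.rpow_le_rpow hn1.le t3 hp0.le
    rw [Real.mul_rpow (by positivity) hn0.le] at hpow
    rw [inv_mul_eq_div, div_div, mul_comm]
    refine div_le_div_of_nonneg_left (by positivity) (Real.rpow_pos_of_pos hn1 p) hpow
  -- Here u need not be a test function for k = 0; the bound of that capacity by 1 suffices.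
  · refine (mul_le_of_le_one_right' hΘ1).trans ?_
    refine (ENNReal.ofReal_le_ofReal (min_le_right _ _)).trans ?_
    rw [← ENNReal.ofReal_toReal hGtop, (hpoly _).lpNorm_eq,
      ENNReal.ofReal_rpow_of_nonneg ENNReal.toReal_nonneg hp0.le, ENNReal.ofReal_rpow_of_pos hn1,
      ← ENNReal.ofReal_div_of_pos (Real.rpow_pos_of_pos hn1 p)]
    refine ENNReal.ofReal_le_ofReal ?_
    rw [le_div_iff₀ (Real.rpow_pos_of_pos hn1 p), ← Real.mul_rpow hc₁.le hn1.le]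
    exact Real.rpow_le_rpow (by positivity) h hp0.le
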